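/- **Setting.** An episodic adversarial MDP consists of a finite state space of size $S$, a finite non-empty action space of size $A$, a horizon $H\ge 1$, $K\ge 1$ episodes, a fixed initial state $s_{\mathrm{init}}$, transition probabilities $p_h(\cdot\mid s,a)$, and cost functions $c^k_h(s,a)\in[0,1]$, $k\in[K]$, $h\in[H]$; assume $S>A$ and $S>H^2$. Costs and delays $d^1,\dots,d^K\in\mathbb{N}$ are arbitrary and fixed before the interaction starts; let $D=\sum_k d^k$, $d_{max}=\max_k d^k$ and $\mathcal F^k=\{j: j+d^j=k\}$. In episode $k$ the learner plays a policy $\pi^k=(\pi^k_h(\cdot\mid s))_{h,s}$, which generates a trajectory $(s^k_h,a^k_h)_{h=1}^H$ with $s_1^k=s_{\mathrm{init}}$. At the end of episode $k$ it observes, for every $j\in\mathcal F^k$, the trajectory of episode $j$ together with either all of $c^j$ (full information) or only $c^j_h(s^j_h,a^j_h)$, $h\in[H]$ (bandit). With $V^{k,\pi}$ the expected total cost of $\pi$ under $c^k$ from $s_{\mathrm{init}}$, the regret is $\mathcal R_K=\sum_{k=1}^K V^{k,\pi^k}-\min_\pi\sum_{k=1}^K V^{k,\pi}$. **Delayed OPPO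 with known $p$** (parameters $\eta,\gamma>0$). Start with $\pi^1_h(a\mid s)=1/A$. At the end of episode $k$, for each $j\in\mathcal F^k$, put $\hat c^j=c^j$ under full information and $$\hat c^j_h(s,a)=\frac{c^j_h(s,a)\,\mathbb I\{s^j_h=s,a^j_h=a\}}{q^{\pi^j}_h(s)\,\pi^j_h(a\mid s)+\gamma}$$ under bandit feedback, where $q^{\pi}_h(s)=\Pr[s_h=s\mid\pi,p]$; compute $V^j_{H+1}=0$, $Q^j_h(s,a)=\hat c^j_h(s,a)+\sum_{s'}p_h(s'\mid s,a)V^j_{h+1}(s')$, $V^j_h(s)=\sum_a\pi^j_h(a\mid s)Q^j_h(s,a)$ for $h=H,\dots,1$; then set $\pi^{k+1}_h(a\mid s)\propto\pi^k_h(a\mid s)\exp\bigl(-\eta\sum_{j\in\mathcal F^k}Q^j_h(s,a)\bigr)$. **Theorem.** There are universal constants $C$ and $m$ such that for every such MDP, all delays and every $\delta\in(0,1)$, with $L=C\bigl(1+\log\frac{HSAK}{\delta}\bigr)^m$: 1. Under full-information feedback, with $\eta=\frac1{H\sqrt{K+D}}$, with probability at least $1-\delta$, $$\mathcal R_K\le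 L\,H^2\sqrt{K+D}.$$ 2. Under bandit feedback, with $\eta=\frac1{H(A^{3/2}K+D)^{2/3}}$ and $\gamma=\frac1{(A^{3/2}K+D)^{1/3}}$, with probability at least $1-\delta$, $$\mathcal R_K\le L\,\bigl(HS\sqrt A\,K^{2/3}+H^2D^{2/3}+H^2d_{max}\bigr).$$ -/

import Mathlib

open scoped ENNReal

universe u v

noncomputable section

/-- The two feedback models. -/
inductive Feedback
  | fullInformation
  | bandit

/-- A finite-horizon episodic MDP with `K` episodes of length `H`, a fixed initial state, transition
probabilities `trans h s a = p_h(· ∣ s, a)`, and a sequence of cost functions with values in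
`[0, 1]`, fixed in advance. Episodes and time steps are numbered from `0`. -/
structure AdversarialMDP (S : Type u) (A : Type v) (H K : ℕ) where
  init : S
  trans : Fin H → S → A → PMF S
  cost : Fin K → Fin H → S → A → ℝ
  cost_mem : ∀ k h s a, cost k h s a ∈ Set.Icc (0 : ℝ) 1

namespace AdversarialMDP

/-- A (stochastic, time dependent) policy: `π h s` is the distribution `π_h(· ∣ s)`. -/
abbrev Policy (S : Type u) (A : Type v) (H : ℕ) := Fin H → S → PMF A

/-- A trajectory `(s_h, a_h)_h`. -/
abbrev Trajectory (S : Type u) (A : Type v) (H : ℕ) := Fin H → S × A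

/-- A played episode: the policy that was used and the trajectory that it generated. -/
abbrev Episode (S : Type u) (A : Type v) (H : ℕ) := Policy S A H × Trajectory S A H

variable {S : Type u} {A : Type v} {H K : ℕ}

/-- Joint law of the first `n` state-action pairs and of the state at time `n`, when `π` is
executed in `M` from the initial state. -/
def rollout (M : AdversarialMDP S A H K) (π : Policy S A H) :
    (n : ℕ) → n ≤ H → PMF ((Fin n → S × A) × S)
  | 0, _ => PMF.pure (Fin.elim0, M.init)
  | n + 1, hn =>
    (M.rollout π n (Nat.le_of_succ_le hn)).bind fun x =>
      (π ⟨n, hn⟩ x.2).bind fun a =>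
        (M.trans ⟨n, hn⟩ x.2 a).bind fun s' =>
          PMF.pure (Fin.snoc (α := fun _ => S × A) x.1 (x.2, a), s')

/-- The law of the trajectory of an episode that is played with `π`. -/
def trajLaw (M : AdversarialMDP S A H K) (π : Policy S A H) : PMF (Trajectory S A H) :=
  (M.rollout π H le_rfl).map Prod.fst

/-- The occupancy measure `q_h(s)`: the probability that `s_h = s` under `π`. -/
def occupancy (M : AdversarialMDP S A H K) (π : Policy S A H) (h : Fin H) (s : S) : ℝ :=
  (((M.trajLaw π).map fun U => (U h).1) s).toReal

/-- The value of `π` in episode `k` from the initial state: the expected total cost. -/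
def value [Fintype S] [Fintype A] (M : AdversarialMDP S A H K) (k : Fin K)
    (π : Policy S A H) : ℝ :=
  ∑ U : Trajectory S A H, (M.trajLaw π U).toReal * ∑ h, M.cost k h (U h).1 (U h).2

/-- The regret of a sequence of played policies against the best fixed policy in hindsight. -/
def regret [Fintype S] [Fintype A] (M : AdversarialMDP S A H K) (π : Fin K → Policy S A H) : ℝ :=
  ∑ k, M.value k (π k) - ⨅ π' : Policy S A H, ∑ k, M.value k π'

/-- The cost estimator of episode `k`, computed from the policy `E.1` and the trajectory `E.2`
of that episode; `γ` is only used under bandit feedback. -/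
def costEst [DecidableEq S] [DecidableEq A] (M : AdversarialMDP S A H K) (fb : Feedback)
    (γ : ℝ) (k : Fin K) (E : Episode S A H) (h : Fin H) (s : S) (a : A) : ℝ :=
  match fb with
  | .fullInformation => M.cost k h s a
  | .bandit =>
    (M.cost k h s a * if E.2 h = (s, a) then 1 else 0) /
      (M.occupancy E.1 h s * (E.1 h s a).toReal + γ)

/-- Policy evaluation by dynamic programming: the value function, at time `h`, of the policy `π`
for the cost function `c`; it is `0` from time `H` on. -/
def evalV [Fintype S] [Fintype A] (M : AdversarialMDP S A H K) (c : Fin H → S → A → ℝ)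
    (π : Policy S A H) (h : ℕ) (s : S) : ℝ :=
  if hh : h < H then
    ∑ a, (π ⟨h, hh⟩ s a).toReal *
      (c ⟨h, hh⟩ s a + ∑ s', (M.trans ⟨h, hh⟩ s a s').toReal * M.evalV c π (h + 1) s')
  else 0
termination_by H - h

/-- The `Q`-function that belongs to `evalV`. -/
def evalQ [Fintype S] [Fintype A] (M : AdversarialMDP S A H K) (c : Fin H → S → A → ℝ)
    (π : Policy S A H) (h : Fin H) (s : S) (a : A) : ℝ :=
  c h s a + ∑ s', (M.trans h s a s').toReal * M.evalV c π (h + 1) s'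

/-- The exponential-weights update `π'_h(a ∣ s) ∝ π_h(a ∣ s) exp (-η q_h(s, a))`. -/
def improve [Fintype A] (η : ℝ) (π : Policy S A H) (q : Fin H → S → A → ℝ) : Policy S A H :=
  fun h s => PMF.normalize
    (fun a => π h s a * ENNReal.ofReal (Real.exp (-η * q h s a)))
    (by
      obtain ⟨a, ha⟩ := (π h s).support_nonempty
      rw [Ne, ENNReal.tsum_eq_zero, not_forall]
      exact ⟨a, mul_ne_zero ((PMF.mem_support_iff _ _).1 ha)
        (ENNReal.ofReal_pos.2 (Real.exp_pos _)).ne'⟩)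
    (by
      rw [tsum_fintype]
      exact ENNReal.sum_ne_top.2 fun a _ =>
        ENNReal.mul_ne_top (PMF.apply_ne_top _ _) ENNReal.ofReal_ne_top)

variable [Fintype S] [DecidableEq S] [Fintype A] [DecidableEq A] [Nonempty A]

/-- The policy that Delayed OPPO with known transition function plays in episode `n`, given the
`n` episodes played so far. The update at the end of an episode `n` uses the episodes `j` whose
feedback arrives at the end of that episode, i.e. those with `j + d j = n`. -/
def nextPolicy (M : AdversarialMDP S A H K) (d : Fin K → ℕ) (fb : Feedback) (η γ : ℝ) :
    (n : ℕ) → n ≤ K → (Fin n → Episode S A H) → Policy S A H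
  | 0, _, _ => fun _ _ => PMF.uniformOfFintype A
  | n + 1, hn, E =>
    improve η (E (Fin.last n)).1 fun h s a =>
      ∑ j ∈ Finset.univ.filter fun j : Fin (n + 1) => (j : ℕ) + d (j.castLE hn) = n,
        M.evalQ (M.costEst fb γ (j.castLE hn) (E j)) (E j).1 h s a

/-- The law of the first `n` episodes when Delayed OPPO with known transition function is run. -/
def delayedOPPO (M : AdversarialMDP S A H K) (d : Fin K → ℕ) (fb : Feedback) (η γ : ℝ) :
    (n : ℕ) → n ≤ K → PMF (Fin n → Episode S A H)
  | 0, _ => PMF.pure Fin.elim0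
  | n + 1, hn =>
    (M.delayedOPPO d fb η γ n (Nat.le_of_succ_le hn)).bind fun E =>
      (M.trajLaw (M.nextPolicy d fb η γ n (Nat.le_of_succ_le hn) E)).map fun U =>
        Fin.snoc (α := fun _ => Episode S A H) E
          (M.nextPolicy d fb η γ n (Nat.le_of_succ_le hn) E, U)

/-- The probability that the regret of Delayed OPPO after all `K` episodes is at most `B`. -/
def probRegretLE (M : AdversarialMDP S A H K) (d : Fin K → ℕ) (fb : Feedback) (η γ B : ℝ) :
    ℝ≥0∞ :=
  (M.delayedOPPO d fb η γ K le_rfl).toOuterMeasure {E | M.regret (fun k => (E k).1) ≤ B}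

end AdversarialMDP

/-- The sum of the delays. -/
def totalDelay {K : ℕ} (d : Fin K → ℕ) : ℕ := ∑ k, d k

/-- The maximal delay. -/
def maxDelay {K : ℕ} (d : Fin K → ℕ) : ℕ := Finset.univ.sup d

end

/-! By the value difference lemma (`evalV_sub_evalV`), the regret against a fixed policy `π'` for
the estimated costs is the expectation, along the states visited by `π'`, of local regrets with
losses `Q^k_h(s, ·)`. At each state the policy is exponential weights on the losses received so far.
`exponentialWeights_delayed_regret` compares it with the potential containing every loss, delayed or
not. The price is a second-order term: `q^k` times itself plus the losses still missing in round
`k`. If `Q ≤ B`, this is at most `η B (1 + #missing) V^k_h(s)`, linear in the cost, and the missing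
counts sum to at most `D`.

Under full information `B = H` and the bound is deterministic.

Under bandit feedback `B = H / γ`, and three quantities must be compared with their true
counterparts: the estimated value of `π'`, the second-order term, and the estimated value of the
played policies. The first two must not be too large. Implicit exploration gives `E exp (γ (ĉ - c))
≤ 1` for each state-action pair, and Jensen's inequality extends this to positive linear functionals
of the cost (`expect_exp_functional_costEst_le`). The third must not be too small, which follows
from a bias bound and a second-order expansion (`expect_exp_value_sub_evalV_costEst_le`). Products
of such exponentials form a supermartingale along the run, so Markov's inequality makes each event
fail with probability at most `δ / 3`. -/

noncomputable section

/-! ### Expectations over finite types. -/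

namespace PMF

variable {α β : Type*} [Fintype α] [Fintype β]

/-- The expectation of a real function on a finite type. -/
def expect (p : PMF α) (f : α → ℝ) : ℝ := ∑ a, (p a).toReal * f a

theorem sum_toReal (p : PMF α) : ∑ a, (p a).toReal = 1 := by
  rw [← ENNReal.toReal_sum fun a _ => p.apply_ne_top a, ← tsum_fintype (L := .unconditional _),
    p.tsum_coe, ENNReal.toReal_one]

theorem expect_mono (p : PMF α) {f g : α → ℝ} (h : ∀ a, f a ≤ g a) : p.expect f ≤ p.expect g :=
  Finset.sum_le_sum fun a _ => mul_le_mul_of_nonneg_left (h a) ENNReal.toReal_nonneg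

theorem expect_const (p : PMF α) (c : ℝ) : p.expect (fun _ => c) = c := by
  rw [expect, ← Finset.sum_mul, p.sum_toReal, one_mul]

theorem expect_add (p : PMF α) (f g : α → ℝ) :
    p.expect (fun a => f a + g a) = p.expect f + p.expect g := by
  simp [expect, mul_add, Finset.sum_add_distrib]

theorem expect_sub (p : PMF α) (f g : α → ℝ) :
    p.expect (fun a => f a - g a) = p.expect f - p.expect g := by
  simp [expect, mul_sub, Finset.sum_sub_distrib]

theorem expect_const_mul (p : PMF α) (c : ℝ) (f : α → ℝ) :
    p.expect (fun a => c * f a) = c * p.expect f := by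
  simp only [expect, Finset.mul_sum]
  exact Finset.sum_congr rfl fun a _ => by ring

theorem expect_sum {ι : Type*} (p : PMF α) (t : Finset ι) (f : ι → α → ℝ) :
    p.expect (fun a => ∑ i ∈ t, f i a) = ∑ i ∈ t, p.expect (f i) := by
  simp only [expect, Finset.mul_sum]
  exact Finset.sum_comm

theorem expect_pure (a : α) (f : α → ℝ) : (PMF.pure a).expect f = f a := by
  classical
  rw [expect, Finset.sum_eq_single a]
  · simp [PMF.pure_apply]
  · intro b _ hb
    simp [PMF.pure_apply, hb]
  · simp

theorem expect_bind (p : PMF α) (q : α → PMF β) (f : β → ℝ) :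
    (p.bind q).expect f = p.expect fun a => (q a).expect f := by
  have h : ∀ b, ((p.bind q) b).toReal = ∑ a, (p a).toReal * (q a b).toReal := fun b => by
    rw [PMF.bind_apply, tsum_fintype, ENNReal.toReal_sum fun a _ =>
      ENNReal.mul_ne_top (p.apply_ne_top a) ((q a).apply_ne_top b)]
    simp
  simp only [expect, h, Finset.sum_mul, Finset.mul_sum]
  rw [Finset.sum_comm]
  exact Finset.sum_congr rfl fun a _ => Finset.sum_congr rfl fun b _ => by ring

theorem expect_map (p : PMF α) (g : α → β) (f : β → ℝ) :
    (p.map g).expect f = p.expect fun a => f (g a) := by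
  rw [PMF.map, expect_bind]
  simp [expect_pure]

theorem expect_indicator_singleton [DecidableEq α] (p : PMF α) (a : α) :
    p.expect (fun b => if b = a then 1 else 0) = (p a).toReal := by
  simp [expect]

theorem tsum_mul_ofReal (p : PMF α) (f : α → ℝ) (hf : ∀ a, 0 ≤ f a) :
    ∑' a, p a * ENNReal.ofReal (f a) = ENNReal.ofReal (p.expect f) := by
  rw [tsum_fintype, expect, ENNReal.ofReal_sum_of_nonneg fun a _ =>
    mul_nonneg ENNReal.toReal_nonneg (hf a)]
  refine Finset.sum_congr rfl fun a _ => ?_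
  rw [ENNReal.ofReal_mul ENNReal.toReal_nonneg, ENNReal.ofReal_toReal (p.apply_ne_top a)]

end PMF

/-! ### Policy evaluation, value differences and trajectory laws. -/

theorem Nat.induction_from_top {P : ℕ → Prop} (H : ℕ) (base : ∀ h, H ≤ h → P h)
    (step : ∀ h, h < H → P (h + 1) → P h) (h : ℕ) : P h := by
  rcases le_total H h with hh | hh
  · exact base h hh
  · exact Nat.decreasingInduction (motive := fun n _ => P n) (fun n hn ih => step n hn ih)
      (base H le_rfl) hh

namespace AdversarialMDP

variable {S : Type u} {A : Type v} {H K : ℕ} [Fintype S] [Fintype A]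
  (M : AdversarialMDP S A H K)

theorem evalV_of_le (c : Fin H → S → A → ℝ) (π : Policy S A H) {h : ℕ} (hh : H ≤ h) (s : S) :
    M.evalV c π h s = 0 := by
  rw [evalV, dif_neg hh.not_gt]

theorem evalV_of_lt (c : Fin H → S → A → ℝ) (π : Policy S A H) {h : ℕ} (hh : h < H) (s : S) :
    M.evalV c π h s = (π ⟨h, hh⟩ s).expect fun a =>
      c ⟨h, hh⟩ s a + (M.trans ⟨h, hh⟩ s a).expect fun s' => M.evalV c π (h + 1) s' := by
  rw [evalV, dif_pos hh]
  rfl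

theorem evalQ_eq (c : Fin H → S → A → ℝ) (π : Policy S A H) (h : Fin H) (s : S) (a : A) :
    M.evalQ c π h s a = c h s a + (M.trans h s a).expect fun s' => M.evalV c π (h + 1) s' := rfl

theorem evalV_eq_expect_evalQ (c : Fin H → S → A → ℝ) (π : Policy S A H) (h : Fin H) (s : S) :
    M.evalV c π h s = (π h s).expect (M.evalQ c π h s) :=
  M.evalV_of_lt c π h.2 s

theorem evalV_add (c c' : Fin H → S → A → ℝ) (π : Policy S A H) (h : ℕ) (s : S) :
    M.evalV (c + c') π h s = M.evalV c π h s + M.evalV c' π h s := by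
  induction h using Nat.induction_from_top H generalizing s with
  | base h hh => simp [M.evalV_of_le _ _ hh]
  | step h hh ih =>
    simp only [M.evalV_of_lt _ _ hh, ih, PMF.expect_add, Pi.add_apply]
    ring

theorem evalV_smul (r : ℝ) (c : Fin H → S → A → ℝ) (π : Policy S A H) (h : ℕ) (s : S) :
    M.evalV (r • c) π h s = r * M.evalV c π h s := by
  induction h using Nat.induction_from_top H generalizing s with
  | base h hh => simp [M.evalV_of_le _ _ hh]
  | step h hh ih =>
    simp only [M.evalV_of_lt _ _ hh, ih, PMF.expect_const_mul, Pi.smul_apply, smul_eq_mul,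
      ← mul_add]

theorem evalV_mono {c c' : Fin H → S → A → ℝ} (hc : ∀ h s a, c h s a ≤ c' h s a)
    (π : Policy S A H) (h : ℕ) (s : S) : M.evalV c π h s ≤ M.evalV c' π h s := by
  induction h using Nat.induction_from_top H generalizing s with
  | base h hh => simp [M.evalV_of_le _ _ hh]
  | step h hh ih =>
    simp only [M.evalV_of_lt _ _ hh]
    exact PMF.expect_mono _ fun a => add_le_add (hc _ _ _) (PMF.expect_mono _ ih)

theorem evalV_const (r : ℝ) (π : Policy S A H) (h : ℕ) (s : S) :
    M.evalV (fun _ _ _ => r) π h s = ((H - h : ℕ) : ℝ) * r := by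
  induction h using Nat.induction_from_top H generalizing s with
  | base h hh => simp [M.evalV_of_le _ _ hh, Nat.sub_eq_zero_of_le hh]
  | step h hh ih =>
    simp only [M.evalV_of_lt _ _ hh, ih, PMF.expect_const]
    rw [show H - h = (H - (h + 1)) + 1 by omega]
    push_cast
    ring

/-- A policy's value sees only the mean cost at each state. `expect_visit` uses this to replace the
indicator of an action by its probability. -/
theorem evalV_congr {c c' : Fin H → S → A → ℝ} {π : Policy S A H}
    (hc : ∀ h s, (π h s).expect (c h s) = (π h s).expect (c' h s)) (h : ℕ) (s : S) :
    M.evalV c π h s = M.evalV c' π h s := by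
  induction h using Nat.induction_from_top H generalizing s with
  | base h hh => simp [M.evalV_of_le _ _ hh]
  | step h hh ih =>
    simp only [M.evalV_of_lt _ _ hh, PMF.expect_add, ih, hc]

/-- The value difference lemma. -/
theorem evalV_sub_evalV (c : Fin H → S → A → ℝ) (π π' : Policy S A H) (h : ℕ) (s : S) :
    M.evalV c π h s - M.evalV c π' h s =
      M.evalV (fun h s _ => (π h s).expect (M.evalQ c π h s) - (π' h s).expect (M.evalQ c π h s))
        π' h s := by
  induction h using Nat.induction_from_top H generalizing s with
  | base h hh => simp [M.evalV_of_le _ _ hh]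
  | step h hh ih =>
    rw [M.evalV_eq_expect_evalQ c π ⟨h, hh⟩ s, M.evalV_of_lt _ π' hh, M.evalV_of_lt _ π' hh]
    simp only [PMF.expect_add, PMF.expect_const, ← ih, PMF.expect_sub]
    rw [show M.evalQ c π ⟨h, hh⟩ s = fun a => c ⟨h, hh⟩ s a +
      (M.trans ⟨h, hh⟩ s a).expect fun s' => M.evalV c π (h + 1) s' from rfl]
    simp only [PMF.expect_add]
    ring

theorem evalV_nonneg {c : Fin H → S → A → ℝ} (hc : ∀ h s a, 0 ≤ c h s a)
    (π : Policy S A H) (h : ℕ) (s : S) : 0 ≤ M.evalV c π h s := by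
  have := M.evalV_mono hc π h s
  rwa [M.evalV_const, mul_zero] at this

theorem evalQ_nonneg {c : Fin H → S → A → ℝ} (hc : ∀ h s a, 0 ≤ c h s a)
    (π : Policy S A H) (h : Fin H) (s : S) (a : A) : 0 ≤ M.evalQ c π h s a := by
  have := (M.trans h s a).expect_mono fun s' => M.evalV_nonneg hc π (h + 1) s'
  rw [PMF.expect_const] at this
  exact add_nonneg (hc h s a) this

theorem evalQ_le {c : Fin H → S → A → ℝ} {r : ℝ} (hc : ∀ h s a, c h s a ≤ r)
    (π : Policy S A H) (h : Fin H) (s : S) (a : A) (hr : 0 ≤ r) : M.evalQ c π h s a ≤ H * r := by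
  have := (M.trans h s a).expect_mono fun s' => M.evalV_mono hc π (h + 1) s'
  simp only [M.evalV_const, PMF.expect_const] at this
  rw [evalQ_eq]
  have h2 : ((H - (h + 1) : ℕ) : ℝ) + 1 ≤ H := by
    have := h.2
    norm_cast
    omega
  nlinarith [hc h s a]

/-- Policy evaluation as a linear functional of the cost function. -/
def evalLin (π : Policy S A H) (h : ℕ) (s : S) : (Fin H → S → A → ℝ) →ₗ[ℝ] ℝ where
  toFun c := M.evalV c π h s
  map_add' c c' := M.evalV_add c c' π h s
  map_smul' r c := M.evalV_smul r c π h s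

theorem evalLin_apply (π : Policy S A H) (h : ℕ) (s : S) (c : Fin H → S → A → ℝ) :
    M.evalLin π h s c = M.evalV c π h s := rfl

/-- The expected sum over time of the value functions of `π` at the states that `π'` visits, as a
linear functional of the cost function. -/
def evalEvalLin (π π' : Policy S A H) : (Fin H → S → A → ℝ) →ₗ[ℝ] ℝ where
  toFun c := M.evalV (fun h s _ => M.evalV c π h s) π' 0 M.init
  map_add' c c' := by
    rw [← evalV_add]
    congr 1
    funext h s a
    exact M.evalV_add c c' π h s
  map_smul' r c := by
    rw [RingHom.id_apply, smul_eq_mul, ← evalV_smul]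
    congr 1
    funext h s a
    exact M.evalV_smul r c π h s

theorem evalEvalLin_apply (π π' : Policy S A H) (c : Fin H → S → A → ℝ) :
    M.evalEvalLin π π' c = M.evalV (fun h s _ => M.evalV c π h s) π' 0 M.init := rfl

theorem evalEvalLin_one_le (π π' : Policy S A H) :
    M.evalEvalLin π π' (fun _ _ _ => 1) ≤ (H : ℝ) ^ 2 := by
  rw [evalEvalLin_apply]
  refine (M.evalV_mono (c' := fun _ _ _ => (H : ℝ)) (fun h s _ => ?_) _ _ _).trans_eq ?_
  · rw [M.evalV_const, mul_one]
    exact_mod_cast Nat.sub_le _ _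
  · rw [M.evalV_const, Nat.sub_zero, sq]

/-- The cost accumulated so far plus the value to go is a martingale along the rollout. At time `H`
the value to go vanishes, which identifies dynamic programming with the trajectory expectation. -/
theorem expect_rollout (c : Fin H → S → A → ℝ) (π : Policy S A H) (n : ℕ) (hn : n ≤ H) :
    (M.rollout π n hn).expect (fun x => ∑ i : Fin n, c (i.castLE hn) (x.1 i).1 (x.1 i).2 +
      M.evalV c π n x.2) = M.evalV c π 0 M.init := by
  induction n with
  | zero => simp [rollout, PMF.expect_pure]
  | succ n ih =>
    rw [← ih (Nat.le_of_succ_le hn), rollout]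
    simp only [PMF.expect_bind, PMF.expect_pure]
    congr 1
    funext x
    rw [M.evalV_of_lt c π hn]
    simp only [PMF.expect_add, PMF.expect_const, Fin.sum_univ_castSucc, Fin.snoc_castSucc,
      Fin.snoc_last]
    rw [add_assoc]
    rfl

theorem expect_trajLaw (c : Fin H → S → A → ℝ) (π : Policy S A H) :
    (M.trajLaw π).expect (fun U => ∑ h, c h (U h).1 (U h).2) = M.evalV c π 0 M.init := by
  rw [← M.expect_rollout c π H le_rfl, trajLaw, PMF.expect_map]
  congr 1
  funext x
  simp [M.evalV_of_le _ _ le_rfl]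

theorem value_eq_evalV (k : Fin K) (π : Policy S A H) :
    M.value k π = M.evalV (M.cost k) π 0 M.init :=
  M.expect_trajLaw (M.cost k) π

theorem occupancy_eq [DecidableEq S] (π : Policy S A H) (h : Fin H) (s : S) :
    M.occupancy π h s = (M.trajLaw π).expect fun U => if (U h).1 = s then 1 else 0 := by
  rw [occupancy, ← PMF.expect_indicator_singleton, PMF.expect_map]

theorem expect_visit [DecidableEq S] [DecidableEq A] (π : Policy S A H) (h : Fin H) (s : S) (a : A) :
    (M.trajLaw π).expect (fun U => if U h = (s, a) then 1 else 0) =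
      M.occupancy π h s * (π h s a).toReal := by
  -- A function of the pair at time `h` is a total cost concentrated at that time.
  have h1 : ∀ f : S → A → ℝ, (M.trajLaw π).expect (fun U => f (U h).1 (U h).2) =
      M.evalV (fun i s a => if i = h then f s a else 0) π 0 M.init := fun f => by
    rw [← M.expect_trajLaw]
    congr 1
    funext U
    simp
  have h2 := h1 fun s' a' => if (s', a') = (s, a) then 1 else 0
  have h3 := h1 fun s' _ => (π h s a).toReal * if s' = s then 1 else 0
  rw [PMF.expect_const_mul, ← occupancy_eq, mul_comm] at h3
  rw [h3]
  refine h2.trans (M.evalV_congr (fun i s' => ?_) _ _)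
  by_cases hi : i = h
  · subst hi
    by_cases hs : s' = s
    · subst hs
      simp [PMF.expect_const, PMF.expect_indicator_singleton]
    · simp [hs, PMF.expect_const]
  · simp [hi]

end AdversarialMDP

/-! ### Exponential weights with delayed losses. -/

section ExponentialWeights

open Real

theorem Real.one_sub_exp_neg_ge {x : ℝ} (hx : 0 ≤ x) : x - x ^ 2 ≤ 1 - exp (-x) := by
  have h1 : 1 + x ≤ exp x := by linarith [add_one_le_exp x]
  have h2 : exp (-x) * (1 + x) ≤ 1 := by
    calc exp (-x) * (1 + x) ≤ exp (-x) * exp x := by gcongr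
      _ = 1 := by rw [← exp_add]; simp
  have h3 : exp (-x) ≤ 1 / (1 + x) := by rwa [le_div_iff₀ (by linarith)]
  have h4 : 1 / (1 + x) ≤ 1 - x + x ^ 2 := by
    rw [div_le_iff₀ (by linarith)]
    nlinarith [pow_nonneg hx 3]
  linarith

/-- Write the right side as `(1 - e⁻ˣ) - (1 - e⁻ʸ)(1 - e⁻ˣ)`. The first term is at least `x - x²`
and the product is at most `y x`. -/
theorem Real.exp_neg_mul_one_sub_exp_neg_ge {x y : ℝ} (hx : 0 ≤ x) (hy : 0 ≤ y) :
    x - x ^ 2 - y * x ≤ exp (-y) * (1 - exp (-x)) := by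
  have h1 := one_sub_exp_neg_ge hx
  have h2 : 1 - exp (-x) ≤ x := by linarith [add_one_le_exp (-x)]
  have h3 : 1 - exp (-y) ≤ y := by linarith [add_one_le_exp (-y)]
  have h4 : 0 ≤ 1 - exp (-x) := by
    have := exp_le_one_iff.2 (neg_nonpos.2 hx)
    linarith
  nlinarith [mul_le_mul h3 h2 h4 hy]

variable {A : Type*} [Fintype A] [Nonempty A]

/-- One step of the potential: `L` holds the received losses, `N` the missing ones and `q` the new
one. Use `log z ≤ z - 1`. The resulting normalizer includes `N`, hence is at most the one of the
played distribution, and the numerator is nonnegative, so the larger normalizer may replace it. -/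
theorem log_sum_exp_sub_le {L N q : A → ℝ} (hN : ∀ a, 0 ≤ N a) (hq : ∀ a, 0 ≤ q a) :
    log (∑ a, exp (-(L a + N a + q a))) - log (∑ a, exp (-(L a + N a))) ≤
      -∑ a, exp (-L a) / (∑ b, exp (-L b)) * (q a - q a ^ 2 - N a * q a) := by
  have hpos : ∀ f : A → ℝ, 0 < ∑ a, exp (f a) := fun f =>
    Finset.sum_pos (fun a _ => exp_pos _) Finset.univ_nonempty
  set Z := ∑ b, exp (-L b) with hZ
  set D := ∑ a, exp (-(L a + N a)) with hD
  have hZ0 : 0 < Z := hpos _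
  have hD0 : 0 < D := hpos _
  have hDZ : D ≤ Z := Finset.sum_le_sum fun a _ => exp_le_exp.2 (by linarith [hN a])
  rw [← log_div (hpos _).ne' hD0.ne']
  refine (log_le_sub_one_of_pos (div_pos (hpos _) hD0)).trans ?_
  have h1 : (∑ a, exp (-(L a + N a + q a))) / D - 1 =
      -((∑ a, exp (-L a) * (exp (-N a) * (1 - exp (-q a)))) / D) := by
    rw [div_sub_one hD0.ne', ← neg_div]
    congr 1
    rw [hD, ← Finset.sum_sub_distrib, ← Finset.sum_neg_distrib]
    refine Finset.sum_congr rfl fun a _ => ?_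
    rw [neg_add, exp_add, neg_add, exp_add]
    ring
  rw [h1, neg_le_neg_iff]
  have h2 : ∀ a, 0 ≤ exp (-L a) * (exp (-N a) * (1 - exp (-q a))) := fun a => by
    have := exp_le_one_iff.2 (neg_nonpos.2 (hq a))
    have h3 : 0 ≤ 1 - exp (-q a) := by linarith
    positivity
  calc ∑ a, exp (-L a) / Z * (q a - q a ^ 2 - N a * q a)
      = (∑ a, exp (-L a) * (q a - q a ^ 2 - N a * q a)) / Z := by
        rw [Finset.sum_div]
        exact Finset.sum_congr rfl fun a _ => by ring
    _ ≤ (∑ a, exp (-L a) * (exp (-N a) * (1 - exp (-q a)))) / Z := by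
        gcongr with a
        exact exp_neg_mul_one_sub_exp_neg_ge (hq a) (hN a)
    _ ≤ _ := by
        gcongr
        exact Finset.sum_nonneg fun a _ => h2 a

/-- The indices whose feedback is still missing at the start of round `k`. -/
def missing {K : ℕ} (d : Fin K → ℕ) (k : Fin K) : Finset (Fin K) :=
  Finset.univ.filter fun j => (j : ℕ) < k ∧ (k : ℕ) ≤ j + d j

/-- Missing indices lie in the window of length `maxDelay d` just before `k`. -/
theorem card_missing_le {K : ℕ} (d : Fin K → ℕ) (k : Fin K) :
    (missing d k).card ≤ maxDelay d := by
  have h : (missing d k).card ≤ (Finset.Ico ((k : ℕ) - maxDelay d) k).card := by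
    refine Finset.card_le_card_of_injOn (fun j => (j : ℕ)) (fun j hj => ?_)
      (fun i _ j _ hij => Fin.ext hij)
    have h1 := (Finset.mem_filter.1 hj).2
    have h2 : d j ≤ maxDelay d := Finset.le_sup (f := d) (Finset.mem_univ j)
    simp only [Finset.coe_Ico, Set.mem_Ico]
    omega
  rw [Nat.card_Ico] at h
  omega

/-- Double counting: index `j` is missing only in rounds of `(j, j + d j]`. -/
theorem sum_card_missing_le {K : ℕ} (d : Fin K → ℕ) :
    ∑ k, (missing d k).card ≤ totalDelay d := by
  have h1 : ∑ k, (missing d k).card =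
      ∑ j : Fin K, (Finset.univ.filter fun k : Fin K => (j : ℕ) < k ∧ (k : ℕ) ≤ j + d j).card := by
    simp only [missing, Finset.card_filter]
    exact Finset.sum_comm
  rw [h1]
  refine Finset.sum_le_sum fun j _ => ?_
  have h : (Finset.univ.filter fun k : Fin K => (j : ℕ) < k ∧ (k : ℕ) ≤ j + d j).card ≤
      (Finset.Ioc (j : ℕ) (j + d j)).card := by
    refine Finset.card_le_card_of_injOn (fun j => (j : ℕ)) (fun k hk => ?_)
      (fun i _ j _ hij => Fin.ext hij)
    simpa using hk
  rwa [Nat.card_Ioc, Nat.add_sub_cancel_left] at h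

/-- The regret of exponential weights with delayed nonnegative losses. -/
theorem exponentialWeights_delayed_regret {K : ℕ} (d : Fin K → ℕ) {η : ℝ} (hη : 0 < η)
    {q p : Fin K → A → ℝ} (hq : ∀ k a, 0 ≤ q k a)
    (hp : ∀ k a, p k a =
      exp (-(η * ∑ j ∈ Finset.univ.filter fun j : Fin K => (j : ℕ) + d j < k, q j a)) /
        ∑ b, exp (-(η * ∑ j ∈ Finset.univ.filter fun j : Fin K => (j : ℕ) + d j < k, q j b)))
    (b : A) :
    ∑ k, ∑ a, p k a * q k a ≤ ∑ k, q k b + log (Fintype.card A) / η +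
      η * ∑ k, ∑ a, p k a * q k a * (q k a + ∑ j ∈ missing d k, q j a) := by
  -- The potential ignores delays: it contains all losses of rounds before `n`, so it telescopes.
  -- Delay enters only through the difference from the played weights.
  let G : ℕ → A → ℝ := fun n a => η * ∑ j ∈ Finset.univ.filter fun j : Fin K => (j : ℕ) < n, q j a
  let F : ℕ → ℝ := fun n => log (∑ a, exp (-G n a))
  have hF0 : F 0 = log (Fintype.card A) := by simp [F, G]
  have hFK : -(η * ∑ k, q k b) ≤ F K := by
    have h1 : -(η * ∑ k, q k b) = log (exp (-G K b)) := by
      rw [log_exp]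
      simp [G]
    rw [h1]
    refine log_le_log (exp_pos _) ?_
    exact Finset.single_le_sum (f := fun a => exp (-G K a)) (fun a _ => (exp_pos _).le)
      (Finset.mem_univ b)
  have htel : ∑ k : Fin K, (F (k + 1) - F k) = F K - F 0 := by
    rw [Fin.sum_univ_eq_sum_range (fun n => F (n + 1) - F n) K, Finset.sum_range_sub]
  have hstep : ∀ k : Fin K, F (k + 1) - F k ≤ -(η * ∑ a, p k a * q k a) +
      η ^ 2 * ∑ a, p k a * q k a * (q k a + ∑ j ∈ missing d k, q j a) := fun k => by
    have hk : ∀ a, G k a =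
        η * (∑ j ∈ Finset.univ.filter fun j : Fin K => (j : ℕ) + d j < k, q j a) +
          η * ∑ j ∈ missing d k, q j a := fun a => by
      rw [← mul_add, missing, ← Finset.sum_union]
      · refine congrArg (η * ·) (Finset.sum_congr ?_ fun _ _ => rfl)
        ext j
        simp only [Finset.mem_filter, Finset.mem_univ, true_and, Finset.mem_union]
        omega
      · rw [Finset.disjoint_filter]
        intro j _ h1 h2
        omega
    have hk1 : ∀ a, G (k + 1) a = G k a + η * q k a := fun a => by
      simp only [G]
      rw [← mul_add, show (Finset.univ.filter fun j : Fin K => (j : ℕ) < k + 1) =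
        insert k (Finset.univ.filter fun j : Fin K => (j : ℕ) < k) by
          ext j
          simp only [Finset.mem_filter, Finset.mem_univ, true_and, Finset.mem_insert, Fin.ext_iff]
          omega, Finset.sum_insert (by simp), add_comm (q k a)]
    have := log_sum_exp_sub_le
      (L := fun a => η * ∑ j ∈ Finset.univ.filter fun j : Fin K => (j : ℕ) + d j < k, q j a)
      (N := fun a => η * ∑ j ∈ missing d k, q j a) (q := fun a => η * q k a)
      (fun a => mul_nonneg hη.le (Finset.sum_nonneg fun j _ => hq j a))
      (fun a => mul_nonneg hη.le (hq k a))
    simp only [F, hk1, hk]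
    refine this.trans_eq ?_
    simp only [← hp]
    rw [Finset.mul_sum, Finset.mul_sum, ← Finset.sum_neg_distrib, ← Finset.sum_neg_distrib,
      ← Finset.sum_add_distrib]
    exact Finset.sum_congr rfl fun a _ => by ring
  have hsum := Finset.sum_le_sum fun k (_ : k ∈ Finset.univ) => hstep k
  rw [htel, hF0, Finset.sum_add_distrib, Finset.sum_neg_distrib, ← Finset.mul_sum,
    ← Finset.mul_sum] at hsum
  refine le_of_mul_le_mul_left ?_ hη
  rw [mul_add, mul_add, mul_div_cancel₀ _ hη.ne']
  nlinarith

end ExponentialWeights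

/-! ### Supermartingale bounds for the law of a run; episodes record policies, so the sample space
is infinite and sums are taken in `ℝ≥0∞`. -/

namespace PMF

theorem tsum_bind_mul {α β : Type*} (p : PMF α) (q : α → PMF β) (f : β → ℝ≥0∞) :
    ∑' b, (p.bind q) b * f b = ∑' a, p a * ∑' b, q a b * f b := by
  simp only [PMF.bind_apply, ← ENNReal.tsum_mul_right, ← ENNReal.tsum_mul_left, mul_assoc]
  exact ENNReal.tsum_comm

theorem tsum_pure_mul {α : Type*} (a : α) (f : α → ℝ≥0∞) :
    ∑' b, (PMF.pure a) b * f b = f a := by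
  rw [tsum_eq_single a fun b hb => by simp [PMF.pure_apply, hb]]
  simp [PMF.pure_apply]

theorem tsum_map_mul {α β : Type*} (p : PMF α) (g : α → β) (f : β → ℝ≥0∞) :
    ∑' b, (p.map g) b * f b = ∑' a, p a * f (g a) := by
  simp only [PMF.map, tsum_bind_mul, Function.comp, tsum_pure_mul]

/-- Markov's inequality. -/
theorem mul_toOuterMeasure_le_tsum {α : Type*} (p : PMF α) (f : α → ℝ≥0∞) (c : ℝ≥0∞) :
    c * p.toOuterMeasure {x | c ≤ f x} ≤ ∑' x, p x * f x := by
  rw [PMF.toOuterMeasure_apply, ← ENNReal.tsum_mul_left]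
  refine ENNReal.tsum_le_tsum fun x => ?_
  by_cases hx : c ≤ f x
  · rw [Set.indicator_of_mem (by exact hx), mul_comm]
    gcongr
  · rw [Set.indicator_of_notMem (by exact hx), mul_zero]
    exact zero_le

theorem one_sub_le_toOuterMeasure {α : Type*} (p : PMF α) {good bad : Set α} {ε : ℝ≥0∞}
    (hbad : p.toOuterMeasure bad ≤ ε) (h : ∀ x ∈ p.support, x ∉ bad → x ∈ good) :
    1 - ε ≤ p.toOuterMeasure good := by
  have h1 : p.toOuterMeasure p.support = 1 := (PMF.toOuterMeasure_apply_eq_one_iff p _).2 le_rfl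
  rw [tsub_le_iff_right, ← h1]
  calc p.toOuterMeasure p.support ≤ p.toOuterMeasure (good ∪ bad) :=
        p.toOuterMeasure.mono fun x hx => by
          by_cases hb : x ∈ bad
          · exact Or.inr hb
          · exact Or.inl (h x hx hb)
    _ ≤ p.toOuterMeasure good + p.toOuterMeasure bad := MeasureTheory.measure_union_le _ _
    _ ≤ _ := by gcongr

end PMF

namespace AdversarialMDP

variable {S : Type u} {A : Type v} {H K : ℕ} [Fintype S] [Fintype A] [DecidableEq S]
  [DecidableEq A] [Nonempty A] (M : AdversarialMDP S A H K) (d : Fin K → ℕ) (fb : Feedback)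
  (η γ : ℝ)

/-- The policies recorded in a run of Delayed OPPO are those that the algorithm computes. -/
theorem policy_eq_nextPolicy_of_mem_support (n : ℕ) (hn : n ≤ K) (E : Fin n → Episode S A H)
    (hE : E ∈ (M.delayedOPPO d fb η γ n hn).support) (k : ℕ) (hk : k < n) :
    (E ⟨k, hk⟩).1 =
      M.nextPolicy d fb η γ k (hk.le.trans hn) fun i => E (i.castLE hk.le) := by
  induction n with
  | zero => exact absurd hk (Nat.not_lt_zero k)
  | succ n ih =>
    rw [delayedOPPO, PMF.mem_support_bind_iff] at hE
    obtain ⟨E', hE', hE⟩ := hE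
    rw [PMF.mem_support_map_iff] at hE
    obtain ⟨U, -, rfl⟩ := hE
    have hcast : ∀ (m : ℕ) (hm : m ≤ n) (i : Fin m),
        Fin.snoc (α := fun _ => Episode S A H) E'
          (M.nextPolicy d fb η γ n (Nat.le_of_succ_le hn) E', U)
          (i.castLE (hm.trans (Nat.le_succ n))) = E' (i.castLE hm) := fun m hm i =>
      Fin.snoc_castSucc (α := fun _ => Episode S A H) _ _ (i.castLE hm)
    rcases Nat.lt_succ_iff_lt_or_eq.1 hk with hk' | rfl
    · rw [show (fun i : Fin k => _) = fun i : Fin k => E' (i.castLE hk'.le) from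
        funext fun i => hcast k hk'.le i, ← ih (Nat.le_of_succ_le hn) E' hE' hk']
      exact congrArg Prod.fst (Fin.snoc_castSucc (α := fun _ => Episode S A H) _ _ ⟨k, hk'⟩)
    · rw [show (fun i : Fin k => _) = E' from funext fun i => hcast k le_rfl i]
      exact congrArg Prod.fst (Fin.snoc_last (α := fun _ => Episode S A H) _ _)

/-- Given the first `n` episodes, the next policy is determined, so the new factor has conditional
mean at most `1`. Requiring `hF` for every policy avoids any reference to how it was chosen. -/
theorem tsum_delayedOPPO_mul_prod_le (F : Fin K → Episode S A H → ℝ≥0∞)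
    (hF : ∀ k π, ∑' U, M.trajLaw π U * F k (π, U) ≤ 1) (n : ℕ) (hn : n ≤ K) :
    ∑' E, M.delayedOPPO d fb η γ n hn E * ∏ i : Fin n, F (i.castLE hn) (E i) ≤ 1 := by
  induction n with
  | zero =>
    rw [delayedOPPO, PMF.tsum_pure_mul]
    simp
  | succ n ih =>
    refine le_trans ?_ (ih (Nat.le_of_succ_le hn))
    rw [delayedOPPO, PMF.tsum_bind_mul]
    refine ENNReal.tsum_le_tsum fun E => ?_
    rw [PMF.tsum_map_mul]
    simp only [Fin.prod_univ_castSucc, Fin.snoc_castSucc, Fin.snoc_last]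
    gcongr
    simp only [mul_left_comm _ (∏ i, _) _]
    rw [ENNReal.tsum_mul_left]
    calc _ ≤ _ * 1 := mul_le_mul_right (hF _ _) _
      _ = _ := mul_one _

/-- An exponential supermartingale bound for sums of functions of the episodes. -/
theorem toOuterMeasure_log_le_sum_le (f : Fin K → Episode S A H → ℝ)
    (hf : ∀ k π, (M.trajLaw π).expect (fun U => Real.exp (f k (π, U))) ≤ 1) {ε : ℝ} (hε : 0 < ε) :
    (M.delayedOPPO d fb η γ K le_rfl).toOuterMeasure
      {E | Real.log (1 / ε) ≤ ∑ k, f k (E k)} ≤ ENNReal.ofReal ε := by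
  have h1 := M.tsum_delayedOPPO_mul_prod_le d fb η γ
    (fun k E => ENNReal.ofReal (Real.exp (f k E))) (fun k π => by
      rw [PMF.tsum_mul_ofReal _ (fun U => Real.exp (f k (π, U))) fun U => (Real.exp_pos _).le]
      exact ENNReal.ofReal_le_one.2 (hf k π)) K le_rfl
  have h2 := (PMF.mul_toOuterMeasure_le_tsum _ _ (ENNReal.ofReal (1 / ε))).trans h1
  have h3 : {E : Fin K → Episode S A H | Real.log (1 / ε) ≤ ∑ k, f k (E k)} ⊆
      {E | ENNReal.ofReal (1 / ε) ≤
        ∏ i : Fin K, ENNReal.ofReal (Real.exp (f (i.castLE le_rfl) (E i)))} := fun E hE => by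
    rw [Set.mem_ofPred_eq, ← ENNReal.ofReal_prod_of_nonneg fun i _ => (Real.exp_pos _).le,
      ← Real.exp_sum]
    refine ENNReal.ofReal_le_ofReal ?_
    rw [← Real.exp_log (one_div_pos.2 hε)]
    exact Real.exp_le_exp.2 hE
  refine (MeasureTheory.measure_mono h3).trans ?_
  rw [one_div, ENNReal.ofReal_inv_of_pos hε] at h2
  have h4 : ENNReal.ofReal ε ≠ 0 := (ENNReal.ofReal_pos.2 hε).ne'
  have h5 := mul_le_mul_right h2 (ENNReal.ofReal ε)
  rw [← mul_assoc, ENNReal.mul_inv_cancel h4 ENNReal.ofReal_ne_top, one_mul, mul_one] at h5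
  rwa [one_div, ENNReal.ofReal_inv_of_pos hε]

end AdversarialMDP

/-! ### Implicit exploration estimates. -/

namespace AdversarialMDP

open Real (exp exp_add exp_pos add_one_le_exp exp_le_one_iff)

variable {S : Type u} {A : Type v} {H K : ℕ}

/-- Jensen's inequality for `Φ / Λ`, completed to a probability by placing the missing mass at the
value `0`. The proof applies `Φ` to the tangent line of `exp` at `t`. -/
theorem exp_positive_functional_le {Φ : (Fin H → S → A → ℝ) →ₗ[ℝ] ℝ}
    (hΦ : ∀ c, (∀ h s a, 0 ≤ c h s a) → 0 ≤ Φ c) {Λ : ℝ} (hΛ : 0 < Λ)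
    (hΦΛ : Φ (fun _ _ _ => 1) ≤ Λ) (γ : ℝ) (x : Fin H → S → A → ℝ) :
    exp (γ / Λ * Φ x) ≤
      Φ (fun h s a => exp (γ * x h s a)) / Λ + (1 - Φ (fun _ _ _ => 1) / Λ) := by
  set t := γ / Λ * Φ x with ht
  set u := Φ (fun _ _ _ => 1) with hu
  have h1 := hΦ ((fun h s a => exp (γ * x h s a)) -
      exp t • ((1 - t) • (fun _ _ _ => 1) + γ • x)) fun h s a => by
    have h2 := add_one_le_exp (γ * x h s a - t)
    have h3 : exp (γ * x h s a) = exp t * exp (γ * x h s a - t) := by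
      rw [← exp_add]
      ring_nf
    simp only [Pi.sub_apply, Pi.smul_apply, Pi.add_apply, smul_eq_mul, h3]
    nlinarith [exp_pos t]
  rw [map_sub, map_smul, map_add, map_smul, map_smul, smul_eq_mul, smul_eq_mul, smul_eq_mul,
    ← hu] at h1
  have h4 : γ * Φ x = Λ * t := by
    rw [ht]
    field_simp
  rw [h4] at h1
  have h5 : exp t * (1 - t) ≤ 1 := by
    calc exp t * (1 - t) ≤ exp t * exp (-t) := by
          gcongr
          linarith [add_one_le_exp (-t)]
      _ = 1 := by rw [← exp_add]; simp
  have h6 : exp t * Λ ≤ Φ (fun h s a => exp (γ * x h s a)) + (Λ - u) := by nlinarith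
  rw [one_sub_div hΛ.ne', ← add_div, le_div_iff₀ hΛ]
  exact h6

theorem expect_map_linear {ι : Type*} [Fintype ι] (p : PMF ι) (Φ : (Fin H → S → A → ℝ) →ₗ[ℝ] ℝ)
    (f : ι → Fin H → S → A → ℝ) :
    p.expect (fun i => Φ (f i)) = Φ (fun h s a => p.expect fun i => f i h s a) := by
  have : (fun h s a => p.expect fun i => f i h s a) = ∑ i, (p i).toReal • f i := by
    funext h s a
    simp [PMF.expect]
  rw [this, map_sum]
  simp [PMF.expect]

theorem visit_nonneg (M : AdversarialMDP S A H K) (π : Policy S A H) (h : Fin H) (s : S) (a : A) :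
    0 ≤ M.occupancy π h s * (π h s a).toReal :=
  mul_nonneg ENNReal.toReal_nonneg ENNReal.toReal_nonneg

theorem costEst_nonneg [DecidableEq S] [DecidableEq A] (M : AdversarialMDP S A H K)
    (fb : Feedback) {γ : ℝ} (hγ : 0 < γ) (k : Fin K) (E : Episode S A H)
    (h : Fin H) (s : S) (a : A) : 0 ≤ M.costEst fb γ k E h s a := by
  cases fb with
  | fullInformation => exact (M.cost_mem k h s a).1
  | bandit =>
    have h1 := (M.cost_mem k h s a).1
    have h2 := M.visit_nonneg E.1 h s a
    simp only [costEst]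
    split_ifs <;> positivity

theorem costEst_bandit_le [DecidableEq S] [DecidableEq A] (M : AdversarialMDP S A H K)
    {γ : ℝ} (hγ : 0 < γ) (k : Fin K) (E : Episode S A H)
    (h : Fin H) (s : S) (a : A) : M.costEst .bandit γ k E h s a ≤ 1 / γ := by
  have h1 := M.cost_mem k h s a
  have h2 := M.visit_nonneg E.1 h s a
  simp only [costEst]
  gcongr
  · split_ifs <;> linarith [h1.2]
  · linarith

variable [Fintype S] [Fintype A] [DecidableEq S] [DecidableEq A] (M : AdversarialMDP S A H K)

/-- The implicit exploration estimator is exponentially optimistic. -/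
theorem expect_exp_costEst_sub_cost_le {γ : ℝ} (hγ : 0 < γ) (k : Fin K) (π : Policy S A H)
    (h : Fin H) (s : S) (a : A) :
    (M.trajLaw π).expect (fun U =>
      exp (γ * (M.costEst .bandit γ k (π, U) h s a - M.cost k h s a))) ≤ 1 := by
  have hc := M.cost_mem k h s a
  have hx := M.visit_nonneg π h s a
  have hE := M.expect_visit π h s a
  set c := M.cost k h s a with hcdef
  set x := M.occupancy π h s * (π h s a).toReal with hxdef
  set y := γ * c / (x + γ) with hy
  have hxγ : 0 < x + γ := by linarith
  have hy0 : 0 ≤ y := div_nonneg (mul_nonneg hγ.le hc.1) hxγ.le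
  have hy1 : y ≤ 1 := by
    rw [hy, div_le_one hxγ]
    nlinarith [hc.2]
  have h1 : ∀ U : Trajectory S A H,
      exp (γ * (M.costEst .bandit γ k (π, U) h s a - c)) =
        exp (-(γ * c)) + exp (-(γ * c)) * (exp y - 1) * if U h = (s, a) then 1 else 0 := fun U => by
    simp only [costEst]
    rw [← hcdef, ← hxdef]
    split_ifs with hU
    · rw [mul_one, mul_one, mul_sub_one, add_sub_cancel, ← exp_add]
      congr 1
      rw [hy]
      ring
    · simp
  simp only [h1]
  rw [PMF.expect_add, PMF.expect_const, PMF.expect_const_mul, hE]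
  have h2 : exp y ≤ 1 + y + y ^ 2 := by
    have := Real.abs_exp_sub_one_sub_id_le (x := y) (by rwa [abs_of_nonneg hy0])
    linarith [(abs_le.1 this).2]
  -- Since `y (x + γ) = γ c`, we have `x y = γ c - γ y`; and `x y ≤ γ` gives `x y² ≤ γ y`. The extra
  -- `γ` in the denominator pays exactly for the quadratic term.
  have h3 : x * (y + y ^ 2) ≤ γ * c := by
    have h4 : y * (x + γ) = γ * c := by rw [hy]; field_simp
    have h5 : y ≤ γ / (x + γ) := by
      rw [hy]
      gcongr
      nlinarith [hc.2]
    have h6 : y * x ≤ γ := by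
      have : x ≤ x + γ := by linarith
      calc y * x ≤ y * (x + γ) := by gcongr
        _ = γ * c := h4
        _ ≤ γ := by nlinarith [hc.2]
    nlinarith
  have h7 : x * (exp y - 1) ≤ γ * c := by nlinarith
  calc exp (-(γ * c)) + exp (-(γ * c)) * (exp y - 1) * x
      = exp (-(γ * c)) * (1 + x * (exp y - 1)) := by ring
    _ ≤ exp (-(γ * c)) * exp (γ * c) := by
        gcongr
        linarith [add_one_le_exp (γ * c)]
    _ = 1 := by rw [← exp_add]; simp

theorem expect_exp_functional_costEst_le {γ : ℝ} (hγ : 0 < γ)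
    {Φ : (Fin H → S → A → ℝ) →ₗ[ℝ] ℝ}
    (hΦ : ∀ c, (∀ h s a, 0 ≤ c h s a) → 0 ≤ Φ c) {Λ : ℝ} (hΛ : 0 < Λ)
    (hΦΛ : Φ (fun _ _ _ => 1) ≤ Λ) (k : Fin K) (π : Policy S A H) :
    (M.trajLaw π).expect (fun U =>
      exp (γ / Λ * (Φ (M.costEst .bandit γ k (π, U)) - Φ (M.cost k)))) ≤ 1 := by
  have h1 : ∀ U : Trajectory S A H,
      exp (γ / Λ * (Φ (M.costEst .bandit γ k (π, U)) - Φ (M.cost k))) ≤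
        1 / Λ * Φ (fun h s a => exp (γ * (M.costEst .bandit γ k (π, U) h s a - M.cost k h s a))) +
          (1 - Φ (fun _ _ _ => 1) / Λ) := fun U => by
    rw [← map_sub, one_div_mul_eq_div]
    exact exp_positive_functional_le hΦ hΛ hΦΛ γ _
  refine (PMF.expect_mono _ h1).trans ?_
  rw [PMF.expect_add, PMF.expect_const, PMF.expect_const_mul, expect_map_linear]
  have h2 := hΦ ((fun _ _ _ => 1) - fun h s a => (M.trajLaw π).expect fun U =>
      exp (γ * (M.costEst .bandit γ k (π, U) h s a - M.cost k h s a))) fun h s a =>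
    sub_nonneg.2 (M.expect_exp_costEst_sub_cost_le hγ k π h s a)
  rw [map_sub, sub_nonneg] at h2
  have h3 := div_le_div_of_nonneg_right h2 hΛ.le
  rw [one_div_mul_eq_div]
  linarith

theorem evalV_eq_sum_visit (c : Fin H → S → A → ℝ) (π : Policy S A H) :
    M.evalV c π 0 M.init =
      ∑ h, ∑ s, ∑ a, M.occupancy π h s * (π h s a).toReal * c h s a := by
  have h1 : ∀ U : Trajectory S A H, ∑ h, c h (U h).1 (U h).2 =
      ∑ h, ∑ s, ∑ a, c h s a * if U h = (s, a) then 1 else 0 := fun U => by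
    refine Finset.sum_congr rfl fun h _ => ?_
    rw [← Fintype.sum_prod_type' (f := fun s a => c h s a * if U h = (s, a) then 1 else 0)]
    simp
  rw [← M.expect_trajLaw]
  simp only [h1, PMF.expect_sum, PMF.expect_const_mul, M.expect_visit]
  simp only [mul_comm]

/-- The implicit exploration estimate of the value of the played policy is not much below the true
value. -/
theorem expect_exp_value_sub_evalV_costEst_le {γ : ℝ} (hγ : 0 < γ) {lam : ℝ} (hlam : 0 ≤ lam)
    (k : Fin K) (π : Policy S A H) :
    (M.trajLaw π).expect (fun U =>
      exp (lam * (M.value k π - M.evalV (M.costEst .bandit γ k (π, U)) π 0 M.init) -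
        (lam * (γ * (H * Fintype.card S * Fintype.card A)) + (lam * H) ^ 2))) ≤ 1 := by
  set V : Trajectory S A H → ℝ := fun U => M.evalV (M.costEst .bandit γ k (π, U)) π 0 M.init
    with hV
  let x : Fin H → S → A → ℝ := fun h s a => M.occupancy π h s * (π h s a).toReal
  have hx : ∀ h s a, 0 ≤ x h s a := fun h s a => M.visit_nonneg π h s a
  have hVeq : ∀ U, V U = ∑ h, ∑ s, ∑ a,
      x h s a * M.cost k h s a / (x h s a + γ) * if U h = (s, a) then 1 else 0 := fun U => by
    simp only [hV, M.evalV_eq_sum_visit, costEst]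
    refine Finset.sum_congr rfl fun h _ => Finset.sum_congr rfl fun s _ =>
      Finset.sum_congr rfl fun a _ => ?_
    simp only [x]
    ring
  have hV0 : ∀ U, 0 ≤ V U := fun U =>
    M.evalV_nonneg (fun h s a => M.costEst_nonneg .bandit hγ k (π, U) h s a) π 0 M.init
  -- Although an estimate can be as large as `1 / γ`, weighting it by its visit probability leaves
  -- at most `1`, and a trajectory visits one pair per time step.
  have hVH : ∀ U, V U ≤ H := fun U => by
    rw [hVeq]
    calc _ ≤ ∑ h : Fin H, ∑ s, ∑ a, if U h = (s, a) then (1 : ℝ) else 0 := by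
          refine Finset.sum_le_sum fun h _ => Finset.sum_le_sum fun s _ =>
            Finset.sum_le_sum fun a _ => ?_
          split_ifs
          · rw [mul_one, div_le_one (by linarith [hx h s a])]
            nlinarith [hx h s a, (M.cost_mem k h s a).2]
          · simp
      _ = H := by
          have : ∀ h : Fin H, ∑ s, ∑ a, (if U h = (s, a) then (1 : ℝ) else 0) = 1 := fun h => by
            rw [← Fintype.sum_prod_type' (f := fun s a => if U h = (s, a) then (1 : ℝ) else 0)]
            simp
          rw [Finset.sum_congr rfl fun h _ => this h]
          simp
  -- The bias of each pair is `γ x c / (x + γ) ≤ γ`.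
  have hEV : M.value k π - (M.trajLaw π).expect V ≤
      γ * (H * Fintype.card S * Fintype.card A) := by
    rw [M.value_eq_evalV, M.evalV_eq_sum_visit, show V = _ from funext hVeq]
    simp only [PMF.expect_sum, PMF.expect_const_mul, M.expect_visit, ← Finset.sum_sub_distrib]
    calc _ ≤ ∑ h : Fin H, ∑ s : S, ∑ a : A, γ := by
          refine Finset.sum_le_sum fun h _ => Finset.sum_le_sum fun s _ =>
            Finset.sum_le_sum fun a _ => ?_
          have h1 := hx h s a
          have h2 := M.cost_mem k h s a
          change x h s a * M.cost k h s a -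
            x h s a * M.cost k h s a / (x h s a + γ) * x h s a ≤ γ
          have h3 : 0 < x h s a + γ := by linarith
          rw [show x h s a * M.cost k h s a -
            x h s a * M.cost k h s a / (x h s a + γ) * x h s a =
              γ * (x h s a * M.cost k h s a) / (x h s a + γ) by field_simp; ring,
            div_le_iff₀ h3]
          have h4 : x h s a * M.cost k h s a ≤ x h s a := by nlinarith [h2.2]
          nlinarith
      _ = _ := by
          simp
          ring
  set B := γ * (H * Fintype.card S * Fintype.card A : ℝ) with hB
  have h1 : (M.trajLaw π).expect (fun U => exp (-(lam * V U))) ≤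
      1 + (-lam * (M.trajLaw π).expect V + (lam * H) ^ 2) := by
    rw [← PMF.expect_const_mul, ← PMF.expect_const (M.trajLaw π) ((lam * H) ^ 2),
      ← PMF.expect_add, ← PMF.expect_const (M.trajLaw π) 1, ← PMF.expect_add]
    refine PMF.expect_mono _ fun U => ?_
    have h2 := Real.one_sub_exp_neg_ge (mul_nonneg hlam (hV0 U))
    have h3 : (lam * V U) ^ 2 ≤ (lam * H) ^ 2 :=
      pow_le_pow_left₀ (mul_nonneg hlam (hV0 U)) (mul_le_mul_of_nonneg_left (hVH U) hlam) 2
    linarith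
  have h2 : ∀ U, exp (lam * (M.value k π - V U) - (lam * B + (lam * H) ^ 2)) =
      exp (lam * M.value k π - (lam * B + (lam * H) ^ 2)) * exp (-(lam * V U)) := fun U => by
    rw [← exp_add]
    ring_nf
  change (M.trajLaw π).expect
    (fun U => exp (lam * (M.value k π - V U) - (lam * B + (lam * H) ^ 2))) ≤ 1
  simp only [h2]
  rw [PMF.expect_const_mul]
  calc _ ≤ exp (lam * M.value k π - (lam * B + (lam * H) ^ 2)) *
        exp (-lam * (M.trajLaw π).expect V + (lam * H) ^ 2) := by
        gcongr
        refine h1.trans ?_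
        linarith [add_one_le_exp (-lam * (M.trajLaw π).expect V + (lam * H) ^ 2)]
    _ ≤ 1 := by
        rw [← exp_add, exp_le_one_iff]
        nlinarith

end AdversarialMDP

/-! ### Deterministic regret bounds for a run. -/

namespace AdversarialMDP

open Real (exp log exp_add exp_pos)

variable {S : Type u} {A : Type v} {H K : ℕ}

theorem toReal_improve [Fintype A] (η : ℝ) (π : Policy S A H) (q : Fin H → S → A → ℝ)
    (h : Fin H) (s : S) (a : A) :
    (improve η π q h s a).toReal =
      (π h s a).toReal * exp (-η * q h s a) / ∑ b, (π h s b).toReal * exp (-η * q h s b) := by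
  rw [improve, PMF.normalize_apply, tsum_fintype, ENNReal.toReal_mul, ENNReal.toReal_inv,
    ENNReal.toReal_sum fun b _ =>
      ENNReal.mul_ne_top (PMF.apply_ne_top _ _) ENNReal.ofReal_ne_top]
  simp only [ENNReal.toReal_mul, ENNReal.toReal_ofReal (exp_pos _).le]
  rw [div_eq_mul_inv]

theorem evalEvalLin_cost_le [Fintype S] [Fintype A] (M : AdversarialMDP S A H K)
    (k : Fin K) (π π' : Policy S A H) :
    M.evalEvalLin π π' (M.cost k) ≤ (H : ℝ) ^ 2 :=
  (M.evalV_mono (fun h s _ => M.evalV_mono (fun h s a => (M.cost_mem k h s a).2) π h s)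
    π' 0 M.init).trans (M.evalEvalLin_one_le π π')

variable [Fintype S] [Fintype A] [DecidableEq S] [DecidableEq A] (M : AdversarialMDP S A H K)

/-- The estimated `Q`-function of an episode. -/
def estQ (fb : Feedback) (γ : ℝ) (E : Fin K → Episode S A H) (k : Fin K) :
    Fin H → S → A → ℝ :=
  M.evalQ (M.costEst fb γ k (E k)) (E k).1

variable [Nonempty A]

/-- The episodes `E` have been played with the policies of Delayed OPPO. -/
def IsRun (d : Fin K → ℕ) (fb : Feedback) (η γ : ℝ) (E : Fin K → Episode S A H) : Prop :=
  ∀ (k : ℕ) (hk : k < K),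
    (E ⟨k, hk⟩).1 = M.nextPolicy d fb η γ k hk.le fun i => E (i.castLE hk.le)

variable {M} {d : Fin K → ℕ} {fb : Feedback} {η γ : ℝ} {E : Fin K → Episode S A H}

/-- Unrolling the updates cancels the normalizers. The inequality `j + d j < k` is strict because
feedback arriving at the end of episode `k` first affects episode `k + 1`. -/
theorem IsRun.toReal_policy (hE : M.IsRun d fb η γ E) (k : ℕ) (hk : k < K) (h : Fin H) (s : S)
    (a : A) : ((E ⟨k, hk⟩).1 h s a).toReal =
      exp (-(η * ∑ j ∈ Finset.univ.filter fun j : Fin K => (j : ℕ) + d j < k,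
        M.estQ fb γ E j h s a)) /
      ∑ b, exp (-(η * ∑ j ∈ Finset.univ.filter fun j : Fin K => (j : ℕ) + d j < k,
        M.estQ fb γ E j h s b)) := by
  induction k generalizing a with
  | zero =>
    rw [hE 0 hk, nextPolicy]
    simp
  | succ k ih =>
    have hk' : k < K := Nat.lt_of_succ_lt hk
    have hsum : ∀ b, ∑ j ∈ Finset.univ.filter fun j : Fin (k + 1) =>
        (j : ℕ) + d (j.castLE hk.le) = k, M.estQ fb γ E (j.castLE hk.le) h s b =
        ∑ j ∈ Finset.univ.filter fun j : Fin K => (j : ℕ) + d j = k, M.estQ fb γ E j h s b :=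
      fun b => by
        refine Finset.sum_bij (fun j _ => j.castLE hk.le) (fun j hj => ?_)
          (fun i _ j _ hij => Fin.castLE_injective _ hij) (fun j hj => ?_) fun _ _ => rfl
        · simpa using hj
        · have hj' := (Finset.mem_filter.1 hj).2
          exact ⟨⟨j, by omega⟩, by simpa using hj', rfl⟩
    have hsplit : ∀ b, ∑ j ∈ Finset.univ.filter fun j : Fin K => (j : ℕ) + d j < k + 1,
        M.estQ fb γ E j h s b =
        ∑ j ∈ Finset.univ.filter fun j : Fin K => (j : ℕ) + d j < k, M.estQ fb γ E j h s b +
        ∑ j ∈ Finset.univ.filter fun j : Fin K => (j : ℕ) + d j = k, M.estQ fb γ E j h s b :=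
      fun b => by
        rw [← Finset.sum_union]
        · refine Finset.sum_congr ?_ fun _ _ => rfl
          ext j
          simp only [Finset.mem_filter, Finset.mem_univ, true_and, Finset.mem_union]
          omega
        · rw [Finset.disjoint_filter]
          intro j _ h1 h2
          omega
    have hexp : ∀ x y : ℝ, exp (-(η * (x + y))) = exp (-(η * x)) * exp (-η * y) := fun x y => by
      rw [← exp_add]
      ring_nf
    simp only [hsplit, hexp, ← hsum]
    rw [hE (k + 1) hk, nextPolicy, toReal_improve]
    have hlast : ∀ b, ((E ((Fin.last k).castLE hk.le)).1 h s b).toReal = _ := ih hk'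
    simp only [hlast]
    simp only [div_mul_eq_mul_div, ← Finset.sum_div]
    rw [div_div_div_cancel_right₀]
    · rfl
    · exact (Finset.sum_pos (fun b _ => exp_pos _) Finset.univ_nonempty).ne'

/-- Only one loss factor of the second-order term is bounded by `B`; the other is kept, leaving the
value of the played policy at `s`, which is linear in the estimated cost and so can be concentrated.
-/
theorem IsRun.sum_expect_sub_expect_le (hE : M.IsRun d fb η γ E) (hη : 0 < η) (hγ : 0 < γ)
    {B : ℝ} (hB : ∀ k h s a, M.estQ fb γ E k h s a ≤ B) (h : Fin H) (s : S) (p : PMF A) :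
    ∑ k, (((E k).1 h s).expect (M.estQ fb γ E k h s) - p.expect (M.estQ fb γ E k h s)) ≤
      log (Fintype.card A) / η + ∑ k, η * B * (1 + (missing d k).card) *
        ((E k).1 h s).expect (M.estQ fb γ E k h s) := by
  have hq : ∀ k a, 0 ≤ M.estQ fb γ E k h s a := fun k a =>
    M.evalQ_nonneg (fun h s a => M.costEst_nonneg fb hγ k (E k) h s a) _ h s a
  have h1 := fun b => exponentialWeights_delayed_regret d hη
    (q := fun k a => M.estQ fb γ E k h s a) (p := fun k a => ((E k).1 h s a).toReal) hq
    (fun k a => hE.toReal_policy k k.2 h s a) b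
  have h2 := p.expect_mono h1
  rw [PMF.expect_const, PMF.expect_add, PMF.expect_add, PMF.expect_const, PMF.expect_const,
    PMF.expect_sum] at h2
  have h3 : η * ∑ k, ∑ a, ((E k).1 h s a).toReal * M.estQ fb γ E k h s a *
      (M.estQ fb γ E k h s a + ∑ j ∈ missing d k, M.estQ fb γ E j h s a) ≤
      ∑ k, η * B * (1 + (missing d k).card) * ((E k).1 h s).expect (M.estQ fb γ E k h s) := by
    simp only [PMF.expect, Finset.mul_sum]
    refine Finset.sum_le_sum fun k _ => Finset.sum_le_sum fun a _ => ?_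
    have h4 : M.estQ fb γ E k h s a + ∑ j ∈ missing d k, M.estQ fb γ E j h s a ≤
        B * (1 + (missing d k).card) := by
      have := Finset.sum_le_card_nsmul (missing d k) (fun j => M.estQ fb γ E j h s a) B
        fun j _ => hB j h s a
      rw [nsmul_eq_mul] at this
      linarith [hB k h s a]
    calc _ ≤ η * (((E k).1 h s a).toReal * M.estQ fb γ E k h s a *
          (B * (1 + (missing d k).card))) := by
          gcongr
          exact mul_nonneg ENNReal.toReal_nonneg (hq k a)
      _ = _ := by ring
  rw [Finset.sum_sub_distrib]
  simp only [PMF.expect] at h2 h3 ⊢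
  linarith

/-- The regret of Delayed OPPO with respect to the estimated costs. -/
theorem IsRun.sum_evalV_sub_evalV_le (hE : M.IsRun d fb η γ E) (hη : 0 < η) (hγ : 0 < γ)
    {B : ℝ} (hB : ∀ k h s a, M.estQ fb γ E k h s a ≤ B) (π' : Policy S A H) :
    ∑ k, (M.evalV (M.costEst fb γ k (E k)) (E k).1 0 M.init -
        M.evalV (M.costEst fb γ k (E k)) π' 0 M.init) ≤
      H * (log (Fintype.card A) / η) + η * B * ∑ k, (1 + ((missing d k).card : ℝ)) *
        M.evalEvalLin (E k).1 π' (M.costEst fb γ k (E k)) := by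
  rw [Finset.sum_congr rfl fun k _ => M.evalV_sub_evalV _ _ π' 0 M.init]
  simp only [← evalLin_apply]
  rw [← map_sum]
  simp only [evalLin_apply]
  let g : Fin K → Fin H → S → A → ℝ := fun k h s _ => M.evalV (M.costEst fb γ k (E k)) (E k).1 h s
  have h1 : M.evalV ((fun _ _ _ => log (Fintype.card A) / η) +
      ∑ k, (η * B * (1 + ((missing d k).card : ℝ))) • g k) π' 0 M.init =
        H * (log (Fintype.card A) / η) + η * B * ∑ k, (1 + ((missing d k).card : ℝ)) *
          M.evalEvalLin (E k).1 π' (M.costEst fb γ k (E k)) := by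
    rw [evalV_add, evalV_const, Nat.sub_zero, ← evalLin_apply, map_sum, Finset.mul_sum]
    simp only [map_smul, evalLin_apply, smul_eq_mul, evalEvalLin_apply, mul_assoc, g]
  rw [← h1]
  refine M.evalV_mono (fun h s a => ?_) _ _ _
  have := hE.sum_expect_sub_expect_le hη hγ hB h s (π' h s)
  simp only [Finset.sum_apply, Pi.add_apply, Pi.smul_apply, smul_eq_mul, g,
    M.evalV_eq_expect_evalQ _ _ h s]
  exact this

theorem sum_one_add_missing_le (d : Fin K → ℕ) :
    ∑ k, (1 + ((missing d k).card : ℝ)) ≤ K + totalDelay d := by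
  rw [Finset.sum_add_distrib]
  have := sum_card_missing_le d
  have h2 : (∑ k, ((missing d k).card : ℝ)) ≤ totalDelay d := by exact_mod_cast this
  simpa using h2

theorem IsRun.sum_value_sub_value_le_of_fullInformation
    (hE : M.IsRun d .fullInformation η γ E) (hη : 0 < η) (hγ : 0 < γ) (π' : Policy S A H) :
    ∑ k, (M.value k (E k).1 - M.value k π') ≤
      H * (log (Fintype.card A) / η) + η * H * ((K + totalDelay d) * (H : ℝ) ^ 2) := by
  simp only [value_eq_evalV]
  refine (hE.sum_evalV_sub_evalV_le hη hγ (B := H) (fun k h s a => ?_) π').trans ?_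
  · have := M.evalQ_le (c := M.cost k) (fun h s a => (M.cost_mem k h s a).2) (E k).1 h s a zero_le_one
    rwa [mul_one] at this
  · gcongr
    calc _ ≤ ∑ k, (1 + ((missing d k).card : ℝ)) * (H : ℝ) ^ 2 := by
          gcongr with k
          exact M.evalEvalLin_cost_le k _ _
      _ ≤ _ := by
          rw [← Finset.sum_mul]
          gcongr
          exact sum_one_add_missing_le d

/-- Split the regret into underestimation of the played values (`h3`), regret for the estimated
costs, and overestimation of the comparator (`h1`). `h2` replaces estimated by true costs in the
second-order term. -/
theorem IsRun.sum_value_sub_value_le_of_bandit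
    (hE : M.IsRun d .bandit η γ E) (hH : 0 < H) (hη : 0 < η) (hγ : 0 < γ) (π' : Policy S A H)
    {ℓ lam : ℝ} (hlam : 0 < lam)
    (h1 : ∑ k, γ / H * (M.evalLin π' 0 M.init (M.costEst .bandit γ k (E k)) -
      M.evalLin π' 0 M.init (M.cost k)) ≤ ℓ)
    (h2 : ∑ k, γ / ((H : ℝ) ^ 2 * (1 + maxDelay d)) *
      (((1 + ((missing d k).card : ℝ)) • M.evalEvalLin (E k).1 π') (M.costEst .bandit γ k (E k)) -
      ((1 + ((missing d k).card : ℝ)) • M.evalEvalLin (E k).1 π') (M.cost k)) ≤ ℓ)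
    (h3 : ∑ k, (lam * (M.value k (E k).1 -
      M.evalV (M.costEst .bandit γ k (E k)) (E k).1 0 M.init) -
        (lam * (γ * (H * Fintype.card S * Fintype.card A)) + (lam * H) ^ 2)) ≤ ℓ) :
    ∑ k, (M.value k (E k).1 - M.value k π') ≤
      (ℓ / lam + K * (γ * (H * Fintype.card S * Fintype.card A) + lam * (H : ℝ) ^ 2)) +
      (H * (log (Fintype.card A) / η) + η * (H * (1 / γ)) * ((K + totalDelay d) * (H : ℝ) ^ 2 +
        (H : ℝ) ^ 2 * (1 + maxDelay d) * ℓ / γ)) + H * ℓ / γ := by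
  have hH' : (0 : ℝ) < H := by exact_mod_cast hH
  have hΛ : 0 < (H : ℝ) ^ 2 * (1 + maxDelay d) := by positivity
  rw [← Finset.mul_sum, Finset.sum_sub_distrib, div_mul_eq_mul_div, div_le_iff₀ hH'] at h1
  rw [← Finset.mul_sum, Finset.sum_sub_distrib, div_mul_eq_mul_div, div_le_iff₀ hΛ] at h2
  rw [Finset.sum_sub_distrib, ← Finset.mul_sum, Finset.sum_sub_distrib, Finset.sum_const,
    Finset.card_univ, Fintype.card_fin, nsmul_eq_mul] at h3
  have h1' : ∑ k, M.evalV (M.costEst .bandit γ k (E k)) π' 0 M.init - ∑ k, M.value k π' ≤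
      H * ℓ / γ := by
    simp only [value_eq_evalV]
    rw [le_div_iff₀ hγ]
    simp only [evalLin_apply] at h1
    linarith
  have h2' : ∑ k, (1 + ((missing d k).card : ℝ)) *
      M.evalEvalLin (E k).1 π' (M.costEst .bandit γ k (E k)) ≤
      (K + totalDelay d) * (H : ℝ) ^ 2 + (H : ℝ) ^ 2 * (1 + maxDelay d) * ℓ / γ := by
    have h4 : ∑ k, (1 + ((missing d k).card : ℝ)) * M.evalEvalLin (E k).1 π' (M.cost k) ≤
        (K + totalDelay d) * (H : ℝ) ^ 2 := by
      calc _ ≤ ∑ k, (1 + ((missing d k).card : ℝ)) * (H : ℝ) ^ 2 := by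
            gcongr with k
            exact M.evalEvalLin_cost_le k _ _
        _ ≤ _ := by
            rw [← Finset.sum_mul]
            gcongr
            exact sum_one_add_missing_le d
    simp only [LinearMap.smul_apply, smul_eq_mul] at h2
    have h5 : ∑ k, (1 + ((missing d k).card : ℝ)) *
        M.evalEvalLin (E k).1 π' (M.costEst .bandit γ k (E k)) -
        ∑ k, (1 + ((missing d k).card : ℝ)) * M.evalEvalLin (E k).1 π' (M.cost k) ≤
        (H : ℝ) ^ 2 * (1 + maxDelay d) * ℓ / γ := by
      rw [le_div_iff₀ hγ]
      linarith
    linarith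
  have h3' : ∑ k, M.value k (E k).1 -
      ∑ k, M.evalV (M.costEst .bandit γ k (E k)) (E k).1 0 M.init ≤
      ℓ / lam + K * (γ * (H * Fintype.card S * Fintype.card A) + lam * (H : ℝ) ^ 2) := by
    refine le_of_mul_le_mul_left ?_ hlam
    rw [mul_add, mul_div_cancel₀ _ hlam.ne']
    linarith
  have h6 := hE.sum_evalV_sub_evalV_le hη hγ (B := H * (1 / γ)) (fun k h s a =>
    M.evalQ_le (fun h s a => M.costEst_bandit_le hγ k (E k) h s a) _ h s a (by positivity)) π'
  have h7 : η * (H * (1 / γ)) * ∑ k, (1 + ((missing d k).card : ℝ)) *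
      M.evalEvalLin (E k).1 π' (M.costEst .bandit γ k (E k)) ≤ η * (H * (1 / γ)) *
      ((K + totalDelay d) * (H : ℝ) ^ 2 + (H : ℝ) ^ 2 * (1 + maxDelay d) * ℓ / γ) := by
    gcongr
  rw [Finset.sum_sub_distrib] at h6 ⊢
  linarith

end AdversarialMDP

/-! ### Arithmetic of the bandit parameters. -/

theorem Real.rpow_one_third_pow {x : ℝ} (hx : 0 ≤ x) : (x ^ (1 / 3 : ℝ)) ^ 3 = x := by
  rw [← Real.rpow_natCast, ← Real.rpow_mul hx]
  norm_num

theorem Real.rpow_two_thirds {x : ℝ} (hx : 0 ≤ x) : x ^ (2 / 3 : ℝ) = (x ^ (1 / 3 : ℝ)) ^ 2 := by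
  rw [← Real.rpow_natCast, ← Real.rpow_mul hx]
  norm_num

/-- The arithmetic behind the choice of parameters under bandit feedback, in terms of the cube
roots `κ`, `y`, `R` of the numbers of episodes, of the sum of the delays and of the effective
horizon, and of the square root `α` of the number of actions. -/
theorem bandit_bound_le {H S α κ y R m L ℓ lA : ℝ} (hH : 1 ≤ H) (hα : 1 ≤ α) (hκ : 1 ≤ κ)
    (hy : 0 ≤ y) (hR0 : 0 < R) (hR : R ^ 3 = (α * κ) ^ 3 + y ^ 3) (hm : 0 ≤ m) (hαS : α ^ 2 ≤ S)
    (hHS : H ^ 2 ≤ S) (hL : 1 ≤ L) (hℓ0 : 0 ≤ ℓ) (hℓ : ℓ ≤ 3 * L) (hlA : lA ≤ L) :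
    (ℓ / (1 / (H * κ)) + κ ^ 3 * (1 / R * (H * S * α ^ 2) + 1 / (H * κ) * H ^ 2)) +
      (H * (lA / (1 / (H * R ^ 2))) + 1 / (H * R ^ 2) * (H * (1 / (1 / R))) *
        ((κ ^ 3 + y ^ 3) * H ^ 2 + H ^ 2 * (1 + m) * ℓ / (1 / R))) + H * ℓ / (1 / R) + 1 ≤
      18 * L * (H * S * α * κ ^ 2 + H ^ 2 * y ^ 2 + H ^ 2 * m) := by
  have hακ : 1 ≤ α * κ := one_le_mul_of_one_le_of_one_le hα hκ
  have hR1 : α * κ ≤ R := by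
    refine le_of_pow_le_pow_left₀ three_ne_zero hR0.le ?_
    rw [hR]
    exact le_add_of_nonneg_right (pow_nonneg hy 3)
  have hR2 : y ≤ R := by
    refine le_of_pow_le_pow_left₀ three_ne_zero hR0.le ?_
    rw [hR]
    exact le_add_of_nonneg_left (by positivity)
  have hR3 : R ≤ α * κ + y := by
    refine le_of_pow_le_pow_left₀ three_ne_zero (by positivity) ?_
    rw [hR]
    have : 0 ≤ 3 * (α * κ) ^ 2 * y + 3 * (α * κ) * y ^ 2 := by positivity
    nlinarith
  have hκR : κ ≤ R := le_trans (by nlinarith) hR1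
  have hRsq : R ^ 2 ≤ 2 * (α * κ) ^ 2 + 2 * y ^ 2 := by
    nlinarith [sq_nonneg (α * κ - y), pow_le_pow_left₀ hR0.le hR3 2]
  have hS0 : 0 ≤ S := le_trans (sq_nonneg _) hαS
  -- Both size assumptions combine here: `H²` and `α²` are at most `S`, so their geometric mean is
  -- too. This absorbs `H² A K^(2/3)` into the leading term.
  have hHα : H * α ≤ S := by nlinarith [sq_nonneg (H - α)]
  set P := H * S * α * κ ^ 2 with hP
  set X := P + H ^ 2 * y ^ 2 + H ^ 2 * m with hX
  have hP1 : H ^ 2 * (α * κ) ^ 2 ≤ P := by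
    calc H ^ 2 * (α * κ) ^ 2 = H * α * (κ ^ 2) * (H * α) := by ring
      _ ≤ H * α * (κ ^ 2) * S := by gcongr
      _ = P := by rw [hP]; ring
  have hHsq : H ≤ H ^ 2 := by nlinarith
  have hκsq : κ ≤ κ ^ 2 := by nlinarith
  have hP2 : H ^ 2 * κ ^ 2 ≤ P := by
    refine le_trans ?_ hP1
    gcongr
    exact le_mul_of_one_le_left (by positivity) hα
  have hP3 : H ^ 2 ≤ P := le_trans (le_mul_of_one_le_right (by positivity) (by nlinarith)) hP2
  have hP4 : H * κ ≤ P := le_trans (by gcongr) hP2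
  have hP5 : H * κ ^ 2 ≤ P := le_trans (by gcongr) hP2
  have hP0 : 1 ≤ P := by nlinarith
  have hPX : P + H ^ 2 * m ≤ X := by
    rw [hX]
    nlinarith [mul_nonneg (sq_nonneg H) (sq_nonneg y)]
  have hm' : 0 ≤ H ^ 2 * m := by positivity
  have hX2 : H ^ 2 * R ^ 2 ≤ 2 * X := by
    calc H ^ 2 * R ^ 2 ≤ H ^ 2 * (2 * (α * κ) ^ 2 + 2 * y ^ 2) := by gcongr
      _ = 2 * (H ^ 2 * (α * κ) ^ 2) + 2 * (H ^ 2 * y ^ 2) := by ring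
      _ ≤ 2 * X := by linarith
  have hR1' : 1 ≤ R := hακ.trans hR1
  have hX3 : H * R ≤ 2 * X := by
    refine le_trans ?_ hX2
    gcongr
    nlinarith
  have hX0 : 1 ≤ X := by linarith
  have e1 : ℓ / (1 / (H * κ)) ≤ 3 * (L * X) := by
    rw [div_div_eq_mul_div, div_one]
    calc ℓ * (H * κ) ≤ 3 * L * X := by
          gcongr
          linarith
      _ = _ := by ring
  have e2 : κ ^ 3 * (1 / R * (H * S * α ^ 2) + 1 / (H * κ) * H ^ 2) ≤ 2 * X := by
    have h1 : κ ^ 3 * (1 / R * (H * S * α ^ 2)) ≤ P := by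
      rw [one_div_mul_eq_div, ← mul_div_assoc, div_le_iff₀ hR0]
      calc κ ^ 3 * (H * S * α ^ 2) = P * (α * κ) := by rw [hP]; ring
        _ ≤ P * R := by gcongr
    have h2 : κ ^ 3 * (1 / (H * κ) * H ^ 2) = H * κ ^ 2 := by field_simp
    rw [mul_add, h2]
    linarith
  have e3 : H * (lA / (1 / (H * R ^ 2))) ≤ 2 * (L * X) := by
    rw [div_div_eq_mul_div, div_one]
    calc H * (lA * (H * R ^ 2)) = lA * (H ^ 2 * R ^ 2) := by ring
      _ ≤ L * (H ^ 2 * R ^ 2) := by gcongr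
      _ ≤ L * (2 * X) := by gcongr
      _ = _ := by ring
  have e4 : 1 / (H * R ^ 2) * (H * (1 / (1 / R))) *
      ((κ ^ 3 + y ^ 3) * H ^ 2 + H ^ 2 * (1 + m) * ℓ / (1 / R)) ≤ X + 3 * (L * X) := by
    -- The prefactor `η H / γ` equals `1 / R = γ`, which cancels the `1 / γ` of the concentration
    -- error and leaves the `H² d_max` term.
    have h1 : 1 / (H * R ^ 2) * (H * (1 / (1 / R))) *
        ((κ ^ 3 + y ^ 3) * H ^ 2 + H ^ 2 * (1 + m) * ℓ / (1 / R)) =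
        (κ ^ 3 + y ^ 3) * H ^ 2 / R + ℓ * (H ^ 2 + H ^ 2 * m) := by
      field_simp
    rw [h1]
    have h2 : (κ ^ 3 + y ^ 3) * H ^ 2 / R ≤ X := by
      rw [div_le_iff₀ hR0]
      calc (κ ^ 3 + y ^ 3) * H ^ 2 = H ^ 2 * κ ^ 2 * κ + H ^ 2 * y ^ 2 * y := by ring
        _ ≤ H ^ 2 * κ ^ 2 * R + H ^ 2 * y ^ 2 * R := by gcongr
        _ = (H ^ 2 * κ ^ 2 + H ^ 2 * y ^ 2) * R := by ring
        _ ≤ X * R := by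
          gcongr
          linarith
    have h3 : ℓ * (H ^ 2 + H ^ 2 * m) ≤ 3 * L * X := by
      gcongr
      linarith
    linarith
  have e5 : H * ℓ / (1 / R) ≤ 6 * (L * X) := by
    rw [div_div_eq_mul_div, div_one]
    calc H * ℓ * R = ℓ * (H * R) := by ring
      _ ≤ 3 * L * (2 * X) := by gcongr
      _ = _ := by ring
  -- The constant is `3 + 2 + 2 + (1 + 3) + 6`, plus `1` for the additive slack.
  have hLX : X ≤ L * X := le_mul_of_one_le_left (by linarith) hL
  linarith

/-! ### High-probability bounds. -/

namespace AdversarialMDP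

/-- A comparator within `1` of the infimum suffices, so attainment is not needed. It is chosen
before the run, so concentration can be applied to it without a union bound over policies. -/
theorem exists_regret_le {S : Type u} {A : Type v} {H K : ℕ} [Fintype S] [Fintype A]
    [Nonempty A] (M : AdversarialMDP S A H K) : ∃ π' : Policy S A H, ∀ π : Fin K → Policy S A H,
    M.regret π ≤ ∑ k, (M.value k (π k) - M.value k π') + 1 := by
  have : Nonempty (Policy S A H) := ⟨fun _ _ => PMF.uniformOfFintype A⟩
  obtain ⟨π', hπ'⟩ := exists_lt_of_ciInf_lt
    (lt_add_one (⨅ π' : Policy S A H, ∑ k, M.value k π'))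
  refine ⟨π', fun π => ?_⟩
  rw [regret, Finset.sum_sub_distrib]
  linarith

variable {S : Type u} {A : Type v} {H K : ℕ} [Fintype S] [DecidableEq S] [Fintype A]
  [DecidableEq A] [Nonempty A] (M : AdversarialMDP S A H K)

variable {d : Fin K → ℕ} {fb : Feedback} {η γ : ℝ}

theorem isRun_of_mem_support {E : Fin K → Episode S A H}
    (hE : E ∈ (M.delayedOPPO d fb η γ K le_rfl).support) : M.IsRun d fb η γ E :=
  M.policy_eq_nextPolicy_of_mem_support d fb η γ K le_rfl E hE

theorem le_probRegretLE {δ B : ℝ} (hδ : 0 ≤ δ) {bad : Set (Fin K → Episode S A H)}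
    (hbad : (M.delayedOPPO d fb η γ K le_rfl).toOuterMeasure bad ≤ ENNReal.ofReal δ)
    (h : ∀ E, M.IsRun d fb η γ E → E ∉ bad → M.regret (fun k => (E k).1) ≤ B) :
    ENNReal.ofReal (1 - δ) ≤ M.probRegretLE d fb η γ B := by
  rw [ENNReal.ofReal_sub 1 hδ, ENNReal.ofReal_one]
  exact PMF.one_sub_le_toOuterMeasure _ hbad fun E hE hb => h E (M.isRun_of_mem_support hE) hb

theorem le_probRegretLE_fullInformation {δ L : ℝ} (hδ : 0 ≤ δ) (hH : 1 ≤ H) (hK : 1 ≤ K)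
    (hL : 1 ≤ L) (hA : Real.log (Fintype.card A) ≤ L) (hη : η = 1 / (H * √(K + totalDelay d)))
    (hγ : 0 < γ) :
    ENNReal.ofReal (1 - δ) ≤ M.probRegretLE d .fullInformation η γ
      (18 * L * ((H : ℝ) ^ 2 * √(K + totalDelay d))) := by
  obtain ⟨π', hπ'⟩ := M.exists_regret_le
  have hH' : (1 : ℝ) ≤ H := by exact_mod_cast hH
  have hK' : (1 : ℝ) ≤ K := by exact_mod_cast hK
  have hN : (1 : ℝ) ≤ K + totalDelay d := le_add_of_le_of_nonneg hK' (Nat.cast_nonneg _)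
  set N : ℝ := K + totalDelay d with hNdef
  have hr : 1 ≤ √N := Real.one_le_sqrt.2 hN
  have hrr : √N * √N = N := Real.mul_self_sqrt (by linarith)
  have hη0 : 0 < η := by
    rw [hη]
    positivity
  -- Under full information the bound holds on every run.
  refine M.le_probRegretLE hδ (bad := ∅) (by simp) fun E hE _ => (hπ' _).trans ?_
  have h1 := hE.sum_value_sub_value_le_of_fullInformation hη0 hγ π'
  have h2 : (H : ℝ) * (Real.log (Fintype.card A) / η) + η * H * (N * (H : ℝ) ^ 2) =
      (H : ℝ) ^ 2 * √N * (Real.log (Fintype.card A) + 1) := by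
    rw [hη]
    field_simp
    rw [sq √N, hrr]
    ring
  rw [← hNdef, h2] at h1
  set X := (H : ℝ) ^ 2 * √N with hX
  have hX1 : 1 ≤ X := one_le_mul_of_one_le_of_one_le (one_le_pow₀ hH') hr
  have h3 : X * (Real.log (Fintype.card A) + 1) ≤ X * (2 * L) := by
    gcongr
    linarith
  nlinarith

theorem le_probRegretLE_bandit {δ L : ℝ} (hδ : 0 < δ) (hδ1 : δ < 1) (hH : 1 ≤ H) (hK : 1 ≤ K)
    (hAS : Fintype.card A ≤ Fintype.card S) (hHS : H ^ 2 ≤ Fintype.card S)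
    (hL : 1 ≤ L) (hA : Real.log (Fintype.card A) ≤ L) (hℓ : Real.log (1 / (δ / 3)) ≤ 3 * L)
    (hη : η = 1 / (H * ((Fintype.card A : ℝ) ^ (3 / 2 : ℝ) * K + totalDelay d) ^ (2 / 3 : ℝ)))
    (hγ : γ = 1 / ((Fintype.card A : ℝ) ^ (3 / 2 : ℝ) * K + totalDelay d) ^ (1 / 3 : ℝ)) :
    ENNReal.ofReal (1 - δ) ≤ M.probRegretLE d .bandit η γ
      (18 * L * (H * Fintype.card S * √(Fintype.card A) * (K : ℝ) ^ (2 / 3 : ℝ) +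
        (H : ℝ) ^ 2 * (totalDelay d : ℝ) ^ (2 / 3 : ℝ) + (H : ℝ) ^ 2 * maxDelay d)) := by
  obtain ⟨π', hπ'⟩ := M.exists_regret_le
  have hH' : (1 : ℝ) ≤ H := by exact_mod_cast hH
  have hK' : (1 : ℝ) ≤ K := by exact_mod_cast hK
  have hA' : (1 : ℝ) ≤ Fintype.card A := by exact_mod_cast Fintype.card_pos
  set α := √(Fintype.card A : ℝ) with hαdef
  have hα : 1 ≤ α := Real.one_le_sqrt.2 hA'
  have hαsq : α ^ 2 = Fintype.card A := Real.sq_sqrt (by linarith)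
  have hαcube : (Fintype.card A : ℝ) ^ (3 / 2 : ℝ) = α ^ 3 := by
    rw [hαdef, Real.sqrt_eq_rpow, ← Real.rpow_natCast, ← Real.rpow_mul (by linarith)]
    norm_num
  set κ := (K : ℝ) ^ (1 / 3 : ℝ) with hκdef
  have hκ : 1 ≤ κ := Real.one_le_rpow hK' (by norm_num)
  have hκcube : κ ^ 3 = K := Real.rpow_one_third_pow (by linarith)
  set y := (totalDelay d : ℝ) ^ (1 / 3 : ℝ) with hydef
  have hy : 0 ≤ y := by positivity
  have hycube : y ^ 3 = totalDelay d := Real.rpow_one_third_pow (Nat.cast_nonneg _)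
  have hW : 0 < (Fintype.card A : ℝ) ^ (3 / 2 : ℝ) * K + totalDelay d := by positivity
  rw [Real.rpow_two_thirds hW.le] at hη
  set R := ((Fintype.card A : ℝ) ^ (3 / 2 : ℝ) * K + totalDelay d) ^ (1 / 3 : ℝ) with hRdef
  have hR : 0 < R := by positivity
  have hRcube : R ^ 3 = (α * κ) ^ 3 + y ^ 3 := by
    rw [hRdef, Real.rpow_one_third_pow hW.le, hαcube, mul_pow, hκcube, hycube]
  rw [Real.rpow_two_thirds (Nat.cast_nonneg K), Real.rpow_two_thirds (Nat.cast_nonneg _), ← hκdef,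
    ← hydef]
  have hη0 : 0 < η := by
    rw [hη]
    positivity
  have hγ0 : 0 < γ := by
    rw [hγ]
    positivity
  -- With this rate the variance term `K λ H²` is `H K^(2/3)` and `ℓ / λ` is `ℓ H K^(1/3)`; both fit
  -- in the leading term.
  have hlam : 0 < 1 / (H * κ) := by positivity
  have hδ3 : 0 < δ / 3 := by positivity
  have hΛ : 0 < (H : ℝ) ^ 2 * (1 + maxDelay d) := by positivity
  have b1 := M.toOuterMeasure_log_le_sum_le d .bandit η γ (fun k E => γ / H *
    (M.evalLin π' 0 M.init (M.costEst .bandit γ k E) - M.evalLin π' 0 M.init (M.cost k)))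
    (fun k π => M.expect_exp_functional_costEst_le hγ0
      (fun c hc => M.evalV_nonneg hc π' 0 M.init) (by linarith)
      (by rw [evalLin_apply, evalV_const, Nat.sub_zero, mul_one]) k π) hδ3
  -- The functional depends on the policy played in episode `k`, which is harmless since the
  -- exponential bound holds for each fixed policy. Its mass is at most `H² (1 + d_max)`.
  have b2 := M.toOuterMeasure_log_le_sum_le d .bandit η γ
    (fun k E => γ / ((H : ℝ) ^ 2 * (1 + maxDelay d)) *
      (((1 + ((missing d k).card : ℝ)) • M.evalEvalLin E.1 π') (M.costEst .bandit γ k E) -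
        ((1 + ((missing d k).card : ℝ)) • M.evalEvalLin E.1 π') (M.cost k)))
    (fun k π => M.expect_exp_functional_costEst_le hγ0
      (Φ := (1 + ((missing d k).card : ℝ)) • M.evalEvalLin π π')
      (fun c hc => mul_nonneg (by positivity)
        (M.evalV_nonneg (fun h s _ => M.evalV_nonneg hc π h s) π' 0 M.init)) hΛ
      (by
        rw [LinearMap.smul_apply, smul_eq_mul, mul_comm]
        have := card_missing_le d k
        gcongr
        exact M.evalEvalLin_one_le π π') k π) hδ3
  have b3 := M.toOuterMeasure_log_le_sum_le d .bandit η γ (fun k E => 1 / (H * κ) *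
    (M.value k E.1 - M.evalV (M.costEst .bandit γ k E) E.1 0 M.init) -
      (1 / (H * κ) * (γ * (H * Fintype.card S * Fintype.card A)) + (1 / (H * κ) * H) ^ 2))
    (fun k π => M.expect_exp_value_sub_evalV_costEst_le hγ0 hlam.le k π) hδ3
  refine M.le_probRegretLE hδ.le ((MeasureTheory.measure_union_le _ _).trans
    ((add_le_add (MeasureTheory.measure_union_le _ _) le_rfl).trans
      ((add_le_add (add_le_add b1 b2) b3).trans_eq ?_))) fun E hE hbad => (hπ' _).trans ?_
  · rw [← ENNReal.ofReal_add hδ3.le hδ3.le, ← ENNReal.ofReal_add (by positivity) hδ3.le]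
    congr 1
    ring
  · simp only [Set.mem_union, Set.mem_ofPred_eq, not_or, not_le] at hbad
    obtain ⟨⟨h1, h2⟩, h3⟩ := hbad
    have hreg := hE.sum_value_sub_value_le_of_bandit hH hη0 hγ0 π' hlam h1.le h2.le h3.le
    have hℓ0 : 0 ≤ Real.log (1 / (δ / 3)) := by
      refine Real.log_nonneg ?_
      rw [le_div_iff₀ hδ3]
      linarith
    have hbound := bandit_bound_le (S := Fintype.card S) hH' hα hκ hy hR hRcube
      (Nat.cast_nonneg (maxDelay d))
      (by rw [hαsq]; exact_mod_cast hAS) (by exact_mod_cast hHS) hL hℓ0 hℓ hA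
    rw [hη, hγ, ← hαsq, ← hκcube, ← hycube] at hreg
    rw [hαsq] at hreg hbound
    linarith

end AdversarialMDP

end

theorem theorem2 :
    ∃ (C : ℝ) (m : ℕ), ∀ (S : Type u) (A : Type v) [Fintype S] [DecidableEq S] [Fintype A]
      [DecidableEq A] [Nonempty A] (H K : ℕ) (M : AdversarialMDP S A H K) (d : Fin K → ℕ) (δ : ℝ),
      1 ≤ H → 1 ≤ K → Fintype.card A < Fintype.card S → H ^ 2 < Fintype.card S →
      0 < δ → δ < 1 →
      (∀ (η γ : ℝ), η = 1 / (H * √(K + totalDelay d)) → 0 < γ →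
        ENNReal.ofReal (1 - δ) ≤ M.probRegretLE d .fullInformation η γ
          (C * (1 + Real.log (H * Fintype.card S * Fintype.card A * K / δ)) ^ m *
            ((H : ℝ) ^ 2 * √(K + totalDelay d)))) ∧
      (∀ (η γ : ℝ),
        η = 1 / (H * ((Fintype.card A : ℝ) ^ (3 / 2 : ℝ) * K + totalDelay d) ^ (2 / 3 : ℝ)) →
        γ = 1 / ((Fintype.card A : ℝ) ^ (3 / 2 : ℝ) * K + totalDelay d) ^ (1 / 3 : ℝ) →
        ENNReal.ofReal (1 - δ) ≤ M.probRegretLE d .bandit η γ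
          (C * (1 + Real.log (H * Fintype.card S * Fintype.card A * K / δ)) ^ m *
            (H * Fintype.card S * √(Fintype.card A) * (K : ℝ) ^ (2 / 3 : ℝ) +
              (H : ℝ) ^ 2 * (totalDelay d : ℝ) ^ (2 / 3 : ℝ) +
              (H : ℝ) ^ 2 * maxDelay d))) := by
  -- One logarithm suffices: with every factor at least `1`, `1 + log (H S A K / δ)` dominates `log
  -- A`, and three times it dominates `log (3 / δ)`.
  refine ⟨18, 1, ?_⟩
  intro S A _ _ _ _ _ H K M d δ hH hK hAS hHS hδ hδ1
  have hH' : (1 : ℝ) ≤ H := by exact_mod_cast hH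
  have hK' : (1 : ℝ) ≤ K := by exact_mod_cast hK
  have hA' : (1 : ℝ) ≤ Fintype.card A := by exact_mod_cast Fintype.card_pos
  have hS' : (1 : ℝ) ≤ Fintype.card S := by
    have : 1 ≤ Fintype.card S := by omega
    exact_mod_cast this
  have hδ' : 1 ≤ 1 / δ := by
    rw [le_div_iff₀ hδ]
    linarith
  have hlog : Real.log (H * Fintype.card S * Fintype.card A * K / δ) =
      Real.log H + Real.log (Fintype.card S) + Real.log (Fintype.card A) + Real.log K +
        Real.log (1 / δ) := by
    rw [div_eq_mul_one_div, Real.log_mul, Real.log_mul, Real.log_mul, Real.log_mul] <;> positivity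
  have l1 := Real.log_nonneg hH'
  have l2 := Real.log_nonneg hS'
  have l3 := Real.log_nonneg hA'
  have l4 := Real.log_nonneg hK'
  have l5 := Real.log_nonneg hδ'
  have hℓ : Real.log (1 / (δ / 3)) = Real.log 3 + Real.log (1 / δ) := by
    rw [← Real.log_mul (by norm_num) (by positivity)]
    congr 1
    field_simp
  have hlog3 : Real.log 3 ≤ 2 := by
    have := Real.log_le_sub_one_of_pos (show (0 : ℝ) < 3 by norm_num)
    linarith
  rw [pow_one]
  refine ⟨fun η γ hη hγ => ?_, fun η γ hη hγ => ?_⟩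
  · exact M.le_probRegretLE_fullInformation hδ.le hH hK (by linarith) (by linarith) hη hγ
  · exact M.le_probRegretLE_bandit hδ hδ1 hH hK hAS.le hHS.le (by linarith) (by linarith)
      (by linarith) hη hγ
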